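/- Let $K$ be a positive integer. Consider an urn with $K$ colors whose composition after $n$ trials is a (row) vector $\boldsymbol C_n=(C_{n1},\dots,C_{nK})\in[0,\infty)^K$, with total content $S_n=\sum_{i=1}^K C_{ni}$. For a $K\times K$ matrix $\boldsymbol A$ put $\|\boldsymbol A\|=\max_i\sum_j|A_{ij}|$. Suppose that: (i) the initial configuration $\boldsymbol C_0$ is random, almost surely nonzero with nonnegative entries, and has finite mean; (ii) the replacement matrices $\boldsymbol R_1,\boldsymbol R_2,\dots$ are i.i.d. random $K\times K$ matrices with nonnegative entries, $\mathbb E\|\boldsymbol R_1\|<\infty$, and the mean matrix $\boldsymbol H=\mathbb E\boldsymbol R_1$ is irreducible, i.e. for all $i,j$ there is an integer $N\ge 1$ with $(\boldsymbol H^N)_{ij}>0$; (iii) the colors are drawn using an i.i.d. sequence $(U_n)_{n\ge1}$ of Uniform$(0,1)$ random variables that is independent of $(\boldsymbol R_n)_{n\ge1}$: for $n\ge1$, $$\boldsymbol\chi_n=\sum_{i=1}^K \boldsymbol e_i\,\mathbf 1\Big\{U_n\in\Big(\sum_{j=1}^{i-1}\frac{C_{n-1,j}}{S_{n-1}},\ \sum_{j=1}^{i}\frac{C_{n-1,j}}{S_{n-1}}\Big]\Big\},\qquad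 \boldsymbol C_n=\boldsymbol C_{n-1}+\boldsymbol\chi_n\boldsymbol R_n;$$ moreover $\boldsymbol C_0$ is independent of the pair of sequences $\big((\boldsymbol R_n)_{n\ge1},(U_n)_{n\ge1}\big)$. Let $\boldsymbol N_n=\sum_{k=1}^n\boldsymbol\chi_k$ be the vector counting how often each color has been drawn in the first $n$ trials. Then $\boldsymbol H$ has a real dominant eigenvalue $\lambda_{\boldsymbol H}$ (an eigenvalue whose real part is strictly larger than that of every other complex eigenvalue) and a unique left eigenvector $\boldsymbol\pi_{\boldsymbol H}$ for $\lambda_{\boldsymbol H}$ that has strictly positive coordinates summing to $1$, and $$\frac{\boldsymbol C_n}{S_n}\to\boldsymbol\pi_{\boldsymbol H},\qquad \frac{S_n}{n}\to\lambda_{\boldsymbol H},\qquad \frac{\boldsymbol C_n}{n}\to\lambda_{\boldsymbol H}\boldsymbol\pi_{\boldsymbol H},\qquad \frac{\boldsymbol N_n}{n}\to\boldsymbol\pi_{\boldsymbol H},$$ where all four convergences hold both almost surely and in $L^1$. -/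

import Mathlib

open MeasureTheory ProbabilityTheory Filter Topology
open scoped Matrix

attribute [local instance] Matrix.linftyOpNormedAddCommGroup

/-- The product `σ`-algebra on real matrices (generated by the entries). -/
instance instMeasurableSpaceRealMatrix (K : ℕ) : MeasurableSpace (Matrix (Fin K) (Fin K) ℝ) :=
  inferInstanceAs (MeasurableSpace (Fin K → Fin K → ℝ))

/-- With urn composition `c` and total content `∑ l, c l`, the real number `u` selects the colour
`i` for which `u` lies in `(∑_{j < i} c j / ∑ l, c l, ∑_{j ≤ i} c j / ∑ l, c l]`; the value is the
corresponding indicator vector `e_i`. -/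
noncomputable def drawnColor {K : ℕ} (c : Fin K → ℝ) (u : ℝ) : Fin K → ℝ :=
  ∑ i : Fin K,
    (Set.Ioc (∑ j ∈ Finset.Iio i, c j / ∑ l, c l) (∑ j ∈ Finset.Iic i, c j / ∑ l, c l)).indicator
      (fun _ => (Pi.single i 1 : Fin K → ℝ)) u

/-- The composition vector `C_n` after `n` trials, started from `c₀`. Trial `n + 1` uses the
replacement matrix `r n` and the number `u n`: `C_{n+1} = C_n + χ_{n+1} r_n`, with `χ_{n+1}` the
(row) indicator vector of the colour drawn. -/
noncomputable def urnComposition {K : ℕ} (c₀ : Fin K → ℝ) (r : ℕ → Matrix (Fin K) (Fin K) ℝ)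
    (u : ℕ → ℝ) : ℕ → Fin K → ℝ
  | 0 => c₀
  | n + 1 => urnComposition c₀ r u n + drawnColor (urnComposition c₀ r u n) (u n) ᵥ* r n

/-- The total content `S_n` of the urn after `n` trials. -/
noncomputable def urnTotal {K : ℕ} (c₀ : Fin K → ℝ) (r : ℕ → Matrix (Fin K) (Fin K) ℝ)
    (u : ℕ → ℝ) (n : ℕ) : ℝ :=
  ∑ i, urnComposition c₀ r u n i

/-- The count vector `N_n = χ_1 + ⋯ + χ_n`. -/
noncomputable def urnCount {K : ℕ} (c₀ : Fin K → ℝ) (r : ℕ → Matrix (Fin K) (Fin K) ℝ)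
    (u : ℕ → ℝ) (n : ℕ) : Fin K → ℝ :=
  ∑ k ∈ Finset.range n, drawnColor (urnComposition c₀ r u k) (u k)

/-- The entrywise expectation of a random matrix. -/
noncomputable def meanMatrix {K : ℕ} {Ω : Type*} [MeasurableSpace Ω] (μ : Measure Ω)
    (M : Ω → Matrix (Fin K) (Fin K) ℝ) : Matrix (Fin K) (Fin K) ℝ :=
  Matrix.of fun i j => ∫ ω, M ω i j ∂μ

/-- `lam` is the dominant eigenvalue of the real matrix `A`: it is an eigenvalue, and its real part
is strictly larger than that of any other complex eigenvalue. -/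
def IsDominantEigenvalue {K : ℕ} (A : Matrix (Fin K) (Fin K) ℝ) (lam : ℝ) : Prop :=
  (lam : ℂ) ∈ spectrum ℂ (A.map Complex.ofReal) ∧
    ∀ z ∈ spectrum ℂ (A.map Complex.ofReal), z ≠ (lam : ℂ) → z.re < lam

/-- `p` is a left eigenvector of `A` for `lam` with strictly positive coordinates, normalized to be
a probability vector. -/
def IsPerronVector {K : ℕ} (A : Matrix (Fin K) (Fin K) ℝ) (lam : ℝ) (p : Fin K → ℝ) : Prop :=
  (∀ i, 0 < p i) ∧ ∑ i, p i = 1 ∧ p ᵥ* A = lam • p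

/-- The random variables `X n` converge to the constant `a` both almost surely and in `L¹`. -/
def ConvergesAEAndL1 {E Ω : Type*} [NormedAddCommGroup E] [MeasurableSpace Ω] (μ : Measure Ω)
    (X : ℕ → Ω → E) (a : E) : Prop :=
  (∀ᵐ ω ∂μ, Tendsto (fun n => X n ω) atTop (𝓝 a)) ∧
    (∀ n, MemLp (X n) 1 μ) ∧
    Tendsto (fun n => eLpNorm (fun ω => X n ω - a) 1 μ) atTop (𝓝 0)

/-!
The proof separates a law of large numbers from a deterministic stability result. Write `χ_k` for
the draws, `x_k = C_k / S_k` for the proportions, `H` for the mean replacement matrix, and `T_n`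
for the sum of `x_k` over `k < n`.

**Law of large numbers.** Averages of bounded orthogonal variables tend to zero almost surely
(`tendsto_average_of_orthogonal`): their second moments are summable along the squares. The
uniform variable used at a trial is independent of the past, so `χ_k - x_k` are orthogonal and the
average of `χ_k` differs from `T_n / n` by `o(1)`. The replacement matrix of a trial is
independent of the colour drawn, so the same holds for its centred entries once these are
truncated at a level `B`. The part above `B` is dominated by an i.i.d. average of mean tending to
zero as `B` grows, which is why a first moment is enough (`tendsto_average_draw_mul_replacement`).
Together: almost surely `C_n / n = (T_n / n) H + o(1)`.

**Stability.** Consequently `z_n = T_n / n` satisfies `z_{n+1} = z_n + (z_n H / (z_n H 1) - z_n +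
o(1)) / (n + 1)`. Let `p` and `h` be positive left and right eigenvectors of `H` for the Perron
eigenvalue `lam`. In the coordinates `w = z / (z ⬝ᵥ h)` the recursion becomes, after a change of
time, a perturbed Euler scheme for the linear equation `w' = w H - lam w`. The weighted square of
the distance to a multiple of `p`, with weights `h / p`, is dissipated by a Dirichlet form
(`perronForm_dirichlet`), which is coercive on the hyperplane `d ⬝ᵥ h = 0` by irreducibility; no
aperiodicity is needed. Hence `z_n → p` (`Matrix.IsIrreducible.tendsto_average_proportions`), and
all four limits follow.

**Perron–Frobenius.** Eigenvectors exist by maximizing the Collatz–Wielandt function on the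
simplex. The other eigenvalues satisfy `‖z‖ ≤ lam`, so their real parts are smaller than `lam`.

**Convergence in `L¹`.** The proportions and the draw frequencies are bounded, and `S_n / n` is
dominated by the initial content plus an average of i.i.d. integrable variables, which is
uniformly integrable.
-/

/-! ### Perron–Frobenius theory of irreducible matrices -/

section PerronFrobenius

variable {ι : Type*} [Fintype ι] {A : Matrix ι ι ℝ}

lemma Matrix.vecMul_pos_of_pos {P : Matrix ι ι ℝ} (hP : ∀ i j, 0 < P i j) {v : ι → ℝ}
    (hv : ∀ i, 0 ≤ v i) (hne : v ≠ 0) (j : ι) : 0 < (v ᵥ* P) j := by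
  obtain ⟨i, hi⟩ := Function.ne_iff.1 hne
  refine Finset.sum_pos' (fun k _ => mul_nonneg (hv k) (hP k j).le) ⟨i, Finset.mem_univ _, ?_⟩
  exact mul_pos (lt_of_le_of_ne (hv i) (Ne.symm hi)) (hP i j)

variable [DecidableEq ι]

lemma Matrix.vecMul_pow_eq_smul {x : ι → ℝ} {lam : ℝ} (hx : x ᵥ* A = lam • x) (n : ℕ) :
    x ᵥ* A ^ n = lam ^ n • x := by
  induction n with
  | zero => simp
  | succ n ih => rw [pow_succ, ← Matrix.vecMul_vecMul, ih, Matrix.smul_vecMul, hx,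
      smul_smul, pow_succ]

/-- A sum of powers of `A`, one for each pair of indices, is entrywise positive; it replaces the
power `(1 + A) ^ n` of the classical argument. -/
lemma Matrix.IsIrreducible.exists_pos_commute (hA : A.IsIrreducible) :
    ∃ P : Matrix ι ι ℝ, (∀ i j, 0 < P i j) ∧ A * P = P * A ∧
      ∀ (x : ι → ℝ) (lam : ℝ), x ᵥ* A = lam • x → ∃ c : ℝ, x ᵥ* P = c • x := by
  choose N hN hpos using (Matrix.isIrreducible_iff_exists_pow_pos hA.nonneg).1 hA
  refine ⟨∑ i, ∑ j, A ^ N i j, fun i j => ?_, ?_, fun x lam hx => ⟨∑ i, ∑ j, lam ^ N i j, ?_⟩⟩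
  · simp only [Matrix.sum_apply]
    have hnn : ∀ a b, 0 ≤ (A ^ N a b) i j := fun a b => Matrix.pow_apply_nonneg hA.nonneg _ i j
    refine Finset.sum_pos' (fun a _ => Finset.sum_nonneg fun b _ => hnn a b)
      ⟨i, Finset.mem_univ _, ?_⟩
    exact Finset.sum_pos' (fun b _ => hnn i b) ⟨j, Finset.mem_univ _, hpos i j⟩
  · simp only [Finset.mul_sum, Finset.sum_mul]
    refine Finset.sum_congr rfl fun i _ => Finset.sum_congr rfl fun j _ => ?_
    rw [← pow_succ, ← pow_succ']
  · simp only [Matrix.vecMul_sum, Finset.sum_smul, Matrix.vecMul_pow_eq_smul hx]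

/-- A maximizer of the Collatz–Wielandt function `min_j (x A)_j / x_j` on the simplex is an
eigenvector: otherwise multiplication by a positive matrix commuting with `A` would increase it. -/
theorem Matrix.IsIrreducible.exists_perron [Nonempty ι] (hA : A.IsIrreducible) :
    ∃ (lam : ℝ) (p : ι → ℝ), (∀ i, 0 < p i) ∧ ∑ i, p i = 1 ∧ p ᵥ* A = lam • p := by
  obtain ⟨P, hP, hcomm, hPe⟩ := hA.exists_pos_commute
  -- `M` bounds the Collatz–Wielandt function, which makes the set of admissible pairs compact
  set M : ℝ := ∑ i, ∑ j, A i j with hM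
  have hbound : ∀ x ∈ stdSimplex ℝ ι, ∀ t : ℝ, (∀ j, t * x j ≤ (x ᵥ* A) j) → t ≤ M := by
    rintro x ⟨hx0, hx1⟩ t ht
    calc t = ∑ j, t * x j := by rw [← Finset.mul_sum, hx1, mul_one]
      _ ≤ ∑ j, (x ᵥ* A) j := Finset.sum_le_sum fun j _ => ht j
      _ = ∑ i, ∑ j, x i * A i j := by
          simp only [Matrix.vecMul, dotProduct]; exact Finset.sum_comm
      _ ≤ M := by
          refine Finset.sum_le_sum fun i _ => Finset.sum_le_sum fun j _ => ?_
          have : x i ≤ 1 := hx1 ▸ Finset.single_le_sum (fun k _ => hx0 k) (Finset.mem_univ i)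
          exact mul_le_of_le_one_left (hA.nonneg i j) this
  have hM0 : 0 ≤ M := Finset.sum_nonneg fun i _ => Finset.sum_nonneg fun j _ => hA.nonneg i j
  let T : Set ((ι → ℝ) × ℝ) :=
    (stdSimplex ℝ ι ×ˢ Set.Icc 0 M) ∩ {y | ∀ j, y.2 * y.1 j ≤ (y.1 ᵥ* A) j}
  have hTc : IsCompact T := by
    refine ((isCompact_stdSimplex ℝ ι).prod isCompact_Icc).inter_right ?_
    simp only [Set.ofPred_forall]
    refine isClosed_iInter fun j => isClosed_le (by fun_prop) ?_
    simp only [Matrix.vecMul, dotProduct]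
    fun_prop
  have hTne : T.Nonempty := by
    refine ⟨(Pi.single (Classical.arbitrary ι) 1, 0),
      ⟨single_mem_stdSimplex ℝ _, by simp [hM0]⟩, ?_⟩
    intro j
    simp only [zero_mul]
    refine Finset.sum_nonneg fun i _ => mul_nonneg ?_ (hA.nonneg i j)
    exact (single_mem_stdSimplex ℝ (Classical.arbitrary ι)).1 i
  obtain ⟨⟨x, lam⟩, ⟨⟨hxS, hlam0, -⟩, hxl⟩, hmax⟩ :=
    hTc.exists_isMaxOn hTne (f := Prod.snd) continuous_snd.continuousOn
  simp only [Set.mem_ofPred_eq] at hxl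
  simp only at hxS hlam0
  have hxne : x ≠ 0 := by
    rintro rfl
    simpa using hxS.2
  have hyP := Matrix.vecMul_pos_of_pos hP hxS.1 hxne
  have heig : x ᵥ* A = lam • x := by
    by_contra hne
    -- `v P` is positive, so `y = x P` satisfies `lam • y < y A` strictly in every coordinate
    set v := x ᵥ* A - lam • x with hv
    have hvP := Matrix.vecMul_pos_of_pos hP (v := v)
      (fun j => by simpa [hv] using hxl j) (sub_ne_zero.2 hne)
    set y := x ᵥ* P with hy
    have hyA : y ᵥ* A - lam • y = v ᵥ* P := by
      rw [hv, Matrix.sub_vecMul, Matrix.smul_vecMul, hy, Matrix.vecMul_vecMul, Matrix.vecMul_vecMul,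
        hcomm]
    obtain ⟨j₀, hj₀⟩ := Finite.exists_min fun j => (y ᵥ* A) j / y j
    set t := (y ᵥ* A) j₀ / y j₀ with ht
    have hlt : lam < t := by
      rw [ht, lt_div_iff₀ (hyP j₀)]
      have h1 := hvP j₀
      rw [← hyA] at h1
      simp only [Pi.sub_apply, Pi.smul_apply, smul_eq_mul] at h1
      linarith
    set s := ∑ j, y j with hs
    have hspos : 0 < s := Finset.sum_pos (fun j _ => hyP j) Finset.univ_nonempty
    have hmem : s⁻¹ • y ∈ stdSimplex ℝ ι := by
      refine ⟨fun j => mul_nonneg (inv_pos.2 hspos).le (hyP j).le, ?_⟩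
      simp only [Pi.smul_apply, smul_eq_mul, ← Finset.mul_sum]
      exact inv_mul_cancel₀ hspos.ne'
    have hty : ∀ j, t * (s⁻¹ • y) j ≤ ((s⁻¹ • y) ᵥ* A) j := by
      intro j
      have := (le_div_iff₀ (hyP j)).1 (hj₀ j)
      rw [Matrix.smul_vecMul]
      simp only [Pi.smul_apply, smul_eq_mul]
      calc t * (s⁻¹ * y j) = s⁻¹ * (t * y j) := by ring
        _ ≤ _ := mul_le_mul_of_nonneg_left this (inv_pos.2 hspos).le
    have := hmax (show (s⁻¹ • y, t) ∈ T from
      ⟨⟨hmem, hlam0.trans hlt.le, hbound _ hmem t hty⟩, hty⟩)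
    exact absurd this (not_le.2 hlt)
  obtain ⟨c, hc⟩ := hPe x lam heig
  refine ⟨lam, x, fun i => lt_of_le_of_ne (hxS.1 i) fun h0 => ?_, hxS.2, heig⟩
  have := hyP i
  rw [hc, Pi.smul_apply, ← h0, smul_zero] at this
  exact lt_irrefl _ this

/-- The Perron eigenvalue is geometrically simple, by comparison of `d` with the largest multiple
of `p` that lies below it. -/
theorem Matrix.IsIrreducible.eq_smul_perron [Nonempty ι] (hA : A.IsIrreducible) {lam : ℝ}
    {p d : ι → ℝ} (hp : ∀ i, 0 < p i) (hpA : p ᵥ* A = lam • p) (hd : d ᵥ* A = lam • d) :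
    ∃ m : ℝ, d = m • p := by
  obtain ⟨P, hP, -, hPe⟩ := hA.exists_pos_commute
  obtain ⟨i₀, hi₀⟩ := Finite.exists_min fun i => d i / p i
  set m := d i₀ / p i₀ with hm
  refine ⟨m, ?_⟩
  by_contra hne
  have hv : (d - m • p) ᵥ* A = lam • (d - m • p) := by
    rw [Matrix.sub_vecMul, Matrix.smul_vecMul, hd, hpA, smul_sub, smul_comm]
  obtain ⟨c, hc⟩ := hPe _ _ hv
  have := Matrix.vecMul_pos_of_pos hP (v := d - m • p)
    (fun i => by simpa using (le_div_iff₀ (hp i)).1 (hi₀ i)) (sub_ne_zero.2 hne) i₀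
  rw [hc] at this
  simp [hm, div_mul_cancel₀ _ (hp i₀).ne'] at this

/-- A left and a right positive eigenvector; pairing them shows that they share the eigenvalue. -/
theorem Matrix.IsIrreducible.exists_perron_pair [Nonempty ι] (hA : A.IsIrreducible) :
    ∃ (lam : ℝ) (p h : ι → ℝ), 0 < lam ∧ (∀ i, 0 < p i) ∧ ∑ i, p i = 1 ∧ p ᵥ* A = lam • p ∧
      (∀ i, 0 < h i) ∧ A *ᵥ h = lam • h := by
  obtain ⟨lam, p, hp, hp1, hpA⟩ := hA.exists_perron
  obtain ⟨lam', h, hh, -, hhA⟩ := hA.transpose.exists_perron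
  rw [Matrix.vecMul_transpose] at hhA
  have hph : 0 < p ⬝ᵥ h :=
    Finset.sum_pos (fun i _ => mul_pos (hp i) (hh i)) Finset.univ_nonempty
  have heq : lam = lam' := by
    have h1 : p ᵥ* A ⬝ᵥ h = p ⬝ᵥ A *ᵥ h := (Matrix.dotProduct_mulVec p A h).symm
    rw [hpA, hhA, smul_dotProduct, dotProduct_smul, smul_eq_mul, smul_eq_mul] at h1
    exact mul_right_cancel₀ hph.ne' h1
  subst heq
  refine ⟨lam, p, h, ?_, hp, hp1, hpA, hh, hhA⟩
  let i := Classical.arbitrary ι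
  obtain ⟨k, hk0, hk⟩ := (Matrix.isIrreducible_iff_exists_pow_pos hA.nonneg).1 hA i i
  have hnn : 0 ≤ lam * p i := by
    have := congrFun hpA i
    rw [Pi.smul_apply, smul_eq_mul] at this
    rw [← this]
    exact Finset.sum_nonneg fun j _ => mul_nonneg (hp j).le (hA.nonneg j i)
  refine lt_of_le_of_ne (nonneg_of_mul_nonneg_left hnn (hp i)) fun h0 => ?_
  have hpow : 0 < (p ᵥ* A ^ k) i :=
    Finset.sum_pos' (fun j _ => mul_nonneg (hp j).le (Matrix.pow_apply_nonneg hA.nonneg k j i))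
      ⟨i, Finset.mem_univ _, mul_pos (hp i) hk⟩
  rw [Matrix.vecMul_pow_eq_smul hpA, ← h0, zero_pow hk0.ne', zero_smul] at hpow
  exact lt_irrefl _ hpow

lemma Matrix.exists_mulVec_eq_smul_of_mem_spectrum {M : Matrix ι ι ℂ} {z : ℂ}
    (hz : z ∈ spectrum ℂ M) : ∃ v ≠ 0, M *ᵥ v = z • v := by
  rw [spectrum.mem_iff, Matrix.isUnit_iff_isUnit_det, isUnit_iff_ne_zero, not_not,
    ← Matrix.exists_mulVec_eq_zero_iff] at hz
  obtain ⟨v, hv, h⟩ := hz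
  refine ⟨v, hv, ?_⟩
  rw [Matrix.sub_mulVec, Matrix.algebraMap_eq_diagonal, sub_eq_zero] at h
  rw [← h]
  ext i
  simp [Matrix.mulVec_diagonal]

lemma Matrix.mem_spectrum_of_mulVec_eq_smul {M : Matrix ι ι ℂ} {z : ℂ} {v : ι → ℂ}
    (hv : v ≠ 0) (h : M *ᵥ v = z • v) : z ∈ spectrum ℂ M := by
  rw [spectrum.mem_iff, Matrix.isUnit_iff_isUnit_det, isUnit_iff_ne_zero, not_not,
    ← Matrix.exists_mulVec_eq_zero_iff]
  refine ⟨v, hv, ?_⟩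
  rw [Matrix.sub_mulVec, Matrix.algebraMap_eq_diagonal, sub_eq_zero, h]
  ext i
  simp [Matrix.mulVec_diagonal]

/-- A positive right eigenvector `h` bounds the spectral radius: compare an eigenvector with `h` at
a coordinate where `‖v i‖ / h i` is largest. -/
lemma Matrix.norm_le_of_mem_spectrum [Nonempty ι] (hA : ∀ i j, 0 ≤ A i j) {lam : ℝ} {h : ι → ℝ}
    (hh : ∀ i, 0 < h i) (hhA : A *ᵥ h = lam • h) {z : ℂ}
    (hz : z ∈ spectrum ℂ (A.map Complex.ofReal)) : ‖z‖ ≤ lam := by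
  obtain ⟨v, hv, hvz⟩ := Matrix.exists_mulVec_eq_smul_of_mem_spectrum hz
  obtain ⟨i₀, hi₀⟩ := Finite.exists_max fun i => ‖v i‖ / h i
  set m := ‖v i₀‖ / h i₀ with hm
  have hle : ∀ i, ‖v i‖ ≤ m * h i := fun i => (div_le_iff₀ (hh i)).1 (hi₀ i)
  have hmpos : 0 < m := by
    obtain ⟨i, hi⟩ := Function.ne_iff.1 hv
    exact (div_pos (norm_pos_iff.2 hi) (hh i)).trans_le (hi₀ i)
  have hmh : 0 < m * h i₀ := mul_pos hmpos (hh i₀)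
  refine le_of_mul_le_mul_right ?_ hmh
  have h1 := congrFun hvz i₀
  have h2 := congrFun hhA i₀
  simp only [Matrix.mulVec, dotProduct, Matrix.map_apply, Pi.smul_apply, smul_eq_mul] at h1 h2
  calc ‖z‖ * (m * h i₀) = ‖z * v i₀‖ := by
        rw [hm, div_mul_cancel₀ _ (hh i₀).ne', norm_mul]
    _ = ‖∑ j, (A i₀ j : ℂ) * v j‖ := by rw [h1]
    _ ≤ ∑ j, ‖(A i₀ j : ℂ) * v j‖ := norm_sum_le _ _
    _ ≤ ∑ j, m * (A i₀ j * h j) := by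
        refine Finset.sum_le_sum fun j _ => ?_
        rw [norm_mul, Complex.norm_real, Real.norm_of_nonneg (hA i₀ j)]
        calc A i₀ j * ‖v j‖ ≤ A i₀ j * (m * h j) := mul_le_mul_of_nonneg_left (hle j) (hA i₀ j)
          _ = _ := by ring
    _ = lam * (m * h i₀) := by rw [← Finset.mul_sum, h2]; ring

/-- The Perron eigenvalue is dominant: the other eigenvalues lie in the disc `‖z‖ ≤ lam`, which
meets the line `re z = lam` only at `lam`. -/
lemma isDominantEigenvalue_of_pos {K : ℕ} [NeZero K] {A : Matrix (Fin K) (Fin K) ℝ}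
    (hA : ∀ i j, 0 ≤ A i j) {lam : ℝ} {h : Fin K → ℝ} (hh : ∀ i, 0 < h i)
    (hhA : A *ᵥ h = lam • h) : IsDominantEigenvalue A lam := by
  refine ⟨Matrix.mem_spectrum_of_mulVec_eq_smul (v := fun i => (h i : ℂ)) ?_ ?_, fun z hz hne => ?_⟩
  · intro h0
    have := congrFun h0 0
    exact (hh 0).ne' (by simpa using this)
  · ext i
    have := congrFun hhA i
    simp only [Matrix.mulVec, dotProduct, Matrix.map_apply, Pi.smul_apply, smul_eq_mul] at this ⊢
    exact_mod_cast congrArg Complex.ofReal this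
  · have hn := Matrix.norm_le_of_mem_spectrum hA hh hhA hz
    refine lt_of_le_of_ne ((Complex.re_le_norm z).trans hn) fun hre => hne ?_
    have hsq : z.re * z.re + z.im * z.im ≤ lam * lam := by
      rw [← Complex.normSq_apply, Complex.normSq_eq_norm_sq, sq]
      exact mul_self_le_mul_self (norm_nonneg z) hn
    have him : z.im = 0 := by
      rw [hre] at hsq
      nlinarith [mul_self_nonneg z.im]
    exact Complex.ext (by simpa using hre) (by simpa using him)

end PerronFrobenius

/-! ### A Lyapunov form for the normalized linear flow -/

section Lyapunov

variable {ι : Type*} [Fintype ι] {A : Matrix ι ι ℝ}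

/-- The weighted inner product `∑ i, (h i / p i) * a i * b i`. -/
noncomputable def perronForm (p h a b : ι → ℝ) : ℝ := ∑ i, h i / p i * (a i * b i)

/-- The energy dissipated by `d ↦ d A - lam d` is the Dirichlet form of the ratios `d i / p i`. -/
lemma perronForm_dirichlet {lam : ℝ} {p h : ι → ℝ} (hp : ∀ i, 0 < p i)
    (hpA : p ᵥ* A = lam • p) (hhA : A *ᵥ h = lam • h) (d : ι → ℝ) :
    -perronForm p h d (d ᵥ* A - lam • d) =
      (1 / 2) * ∑ i, ∑ j, p i * A i j * h j * (d i / p i - d j / p j) ^ 2 := by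
  have hr : ∀ i, d i = p i * (d i / p i) := fun i => by field_simp [(hp i).ne']
  set r : ι → ℝ := fun i => d i / p i with hrdef
  have hcol : ∀ j, ∑ i, p i * A i j = lam * p j := fun j => congrFun hpA j
  have hrow : ∀ i, ∑ j, A i j * h j = lam * h i := fun i => congrFun hhA i
  have e1 : ∑ i, ∑ j, p i * A i j * h j * r i ^ 2 = ∑ i, lam * (h i * p i * r i ^ 2) := by
    refine Finset.sum_congr rfl fun i _ => ?_
    calc ∑ j, p i * A i j * h j * r i ^ 2 = p i * r i ^ 2 * ∑ j, A i j * h j := by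
          rw [Finset.mul_sum]; exact Finset.sum_congr rfl fun j _ => by ring
      _ = _ := by rw [hrow]; ring
  have e2 : ∑ i, ∑ j, p i * A i j * h j * r j ^ 2 = ∑ i, lam * (h i * p i * r i ^ 2) := by
    rw [Finset.sum_comm]
    refine Finset.sum_congr rfl fun j _ => ?_
    calc ∑ i, p i * A i j * h j * r j ^ 2 = h j * r j ^ 2 * ∑ i, p i * A i j := by
          rw [Finset.mul_sum]; exact Finset.sum_congr rfl fun j _ => by ring
      _ = _ := by rw [hcol]; ring
  have e3 : perronForm p h d (d ᵥ* A - lam • d) =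
      ∑ i, ∑ j, p i * A i j * h j * (r i * r j) - ∑ i, lam * (h i * p i * r i ^ 2) := by
    rw [Finset.sum_comm, ← Finset.sum_sub_distrib]
    refine Finset.sum_congr rfl fun j _ => ?_
    have h1 : ∑ i, p i * A i j * h j * (r i * r j) = h j * r j * ∑ i, d i * A i j := by
      rw [Finset.mul_sum]
      exact Finset.sum_congr rfl fun i _ => by rw [hr i]; ring
    rw [h1]
    simp only [Pi.sub_apply, Pi.smul_apply, smul_eq_mul, Matrix.vecMul, dotProduct]
    have hj : h j / p j * d j = h j * r j := by rw [hrdef]; ring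
    rw [← mul_assoc, hj, mul_sub]
    congr 1
    rw [hr j]
    ring
  have e4 : ∑ i, ∑ j, p i * A i j * h j * (r i - r j) ^ 2 =
      ∑ i, ∑ j, p i * A i j * h j * r i ^ 2 + ∑ i, ∑ j, p i * A i j * h j * r j ^ 2 -
        2 * ∑ i, ∑ j, p i * A i j * h j * (r i * r j) := by
    simp only [Finset.mul_sum, ← Finset.sum_add_distrib, ← Finset.sum_sub_distrib]
    exact Finset.sum_congr rfl fun i _ => Finset.sum_congr rfl fun j _ => by ring
  rw [e4, e1, e2, e3]
  ring

lemma perronForm_self_nonneg {p h : ι → ℝ} (hp : ∀ i, 0 < p i) (hh : ∀ i, 0 < h i) (d : ι → ℝ) :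
    0 ≤ perronForm p h d d :=
  Finset.sum_nonneg fun i _ => mul_nonneg (div_pos (hh i) (hp i)).le (mul_self_nonneg _)

lemma perronForm_smul_smul (p h a b : ι → ℝ) (s t : ℝ) :
    perronForm p h (s • a) (t • b) = s * t * perronForm p h a b := by
  simp only [perronForm, Finset.mul_sum, Pi.smul_apply, smul_eq_mul]
  exact Finset.sum_congr rfl fun i _ => by ring

lemma perronForm_add_smul (p h d e : ι → ℝ) (s : ℝ) :
    perronForm p h (d + s • e) (d + s • e) =
      perronForm p h d d + 2 * s * perronForm p h d e + s ^ 2 * perronForm p h e e := by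
  simp only [perronForm, Finset.mul_sum, ← Finset.sum_add_distrib, Pi.add_apply, Pi.smul_apply,
    smul_eq_mul]
  exact Finset.sum_congr rfl fun i _ => by ring

lemma perronForm_add_right (p h d a b : ι → ℝ) :
    perronForm p h d (a + b) = perronForm p h d a + perronForm p h d b := by
  simp only [perronForm, ← Finset.sum_add_distrib, Pi.add_apply]
  exact Finset.sum_congr rfl fun i _ => by ring

/-- On the hyperplane annihilated by the right eigenvector, the dissipation is coercive: it is
positive on the unit sphere because it vanishes only on eigenvectors, that is, on multiples of
`p`. -/
theorem Matrix.IsIrreducible.exists_perronForm_le [DecidableEq ι] [Nonempty ι]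
    (hA : A.IsIrreducible) {lam : ℝ} {p h : ι → ℝ} (hp : ∀ i, 0 < p i) (hh : ∀ i, 0 < h i)
    (hpA : p ᵥ* A = lam • p) (hhA : A *ᵥ h = lam • h) :
    ∃ c > 0, ∀ d : ι → ℝ, d ⬝ᵥ h = 0 →
      c * perronForm p h d d ≤ -perronForm p h d (d ᵥ* A - lam • d) := by
  set E : (ι → ℝ) → ℝ := fun d => -perronForm p h d (d ᵥ* A - lam • d) with hE
  have hterm : ∀ (d : ι → ℝ) i j, 0 ≤ p i * A i j * h j * (d i / p i - d j / p j) ^ 2 :=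
    fun d i j => mul_nonneg (mul_nonneg (mul_nonneg (hp i).le (hA.nonneg i j)) (hh j).le)
      (sq_nonneg _)
  have hEpos : ∀ d : ι → ℝ, d ⬝ᵥ h = 0 → d ≠ 0 → 0 < E d := by
    intro d hdh hd0
    have hE0 : 0 ≤ E d := by
      rw [hE]
      simp only
      rw [perronForm_dirichlet hp hpA hhA]
      exact mul_nonneg (by norm_num)
        (Finset.sum_nonneg fun i _ => Finset.sum_nonneg fun j _ => hterm d i j)
    refine lt_of_le_of_ne hE0 fun h0 => hd0 ?_
    have hz : ∀ i j, p i * A i j * h j * (d i / p i - d j / p j) ^ 2 = 0 := by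
      rw [hE] at h0
      simp only at h0
      rw [perronForm_dirichlet hp hpA hhA] at h0
      have h1 : ∑ i, ∑ j, p i * A i j * h j * (d i / p i - d j / p j) ^ 2 = 0 := by linarith
      intro i j
      have h2 := (Finset.sum_eq_zero_iff_of_nonneg
        (fun i _ => Finset.sum_nonneg fun j _ => hterm d i j)).1 h1 i (Finset.mem_univ _)
      exact (Finset.sum_eq_zero_iff_of_nonneg (fun j _ => hterm d i j)).1 h2 j (Finset.mem_univ _)
    have hdA : d ᵥ* A = lam • d := by
      ext j
      have hc : ∑ i, p i * A i j = lam * p j := congrFun hpA j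
      simp only [Matrix.vecMul, dotProduct, Pi.smul_apply, smul_eq_mul]
      calc ∑ i, d i * A i j = ∑ i, d j / p j * (p i * A i j) := by
            refine Finset.sum_congr rfl fun i _ => ?_
            rcases eq_or_ne (A i j) 0 with ha | ha
            · simp [ha]
            · have h3 : d i / p i - d j / p j = 0 := by
                have := hz i j
                simpa [(hp i).ne', (hh j).ne', ha] using this
              rw [← sub_eq_zero.1 h3]
              field_simp [(hp i).ne']
        _ = lam * d j := by
            rw [← Finset.mul_sum, hc]
            field_simp [(hp j).ne']
    obtain ⟨m, rfl⟩ := hA.eq_smul_perron hp hpA hdA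
    have hph : 0 < p ⬝ᵥ h :=
      Finset.sum_pos (fun i _ => mul_pos (hp i) (hh i)) Finset.univ_nonempty
    rw [smul_dotProduct, smul_eq_mul, mul_eq_zero] at hdh
    rw [hdh.resolve_right hph.ne', zero_smul]
  have hEsmul : ∀ (s : ℝ) (d : ι → ℝ), E (s • d) = s ^ 2 * E d := by
    intro s d
    simp only [hE]
    rw [Matrix.smul_vecMul, smul_comm lam s d, ← smul_sub, perronForm_smul_smul]
    ring
  have hcont : Continuous E := by
    simp only [hE, perronForm]
    fun_prop
  have hVcont : Continuous fun d : ι → ℝ => perronForm p h d d := by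
    simp only [perronForm]
    fun_prop
  let S : Set (ι → ℝ) := Metric.sphere 0 1 ∩ {d | d ⬝ᵥ h = 0}
  have hSc : IsCompact S := by
    refine (isCompact_sphere _ _).inter_right (isClosed_eq ?_ continuous_const)
    simp only [dotProduct]
    fun_prop
  rcases S.eq_empty_or_nonempty with hS | hS
  · refine ⟨1, one_pos, fun d hdh => ?_⟩
    rcases eq_or_ne d 0 with rfl | hd
    · simp [perronForm]
    · exfalso
      have : ‖d‖⁻¹ • d ∈ S := by
        refine ⟨by simp [norm_smul, norm_ne_zero_iff.2 hd], ?_⟩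
        simp [smul_dotProduct, hdh]
      rw [hS] at this
      exact this
  · obtain ⟨d₀, hd₀, hmin⟩ := hSc.exists_isMinOn hS hcont.continuousOn
    obtain ⟨d₁, -, hmax⟩ := hSc.exists_isMaxOn hS hVcont.continuousOn
    have hd₀ne : d₀ ≠ 0 := by
      rintro rfl
      simpa using hd₀.1
    have hm := hEpos d₀ hd₀.2 hd₀ne
    set V₁ := perronForm p h d₁ d₁
    have hV1 : 0 ≤ V₁ := perronForm_self_nonneg hp hh d₁
    refine ⟨E d₀ / (V₁ + 1), by positivity, fun d hdh => ?_⟩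
    rcases eq_or_ne d 0 with rfl | hd
    · simp [perronForm]
    have hn : 0 < ‖d‖ := norm_pos_iff.2 hd
    have hmem : ‖d‖⁻¹ • d ∈ S := by
      refine ⟨by simp [norm_smul, hn.ne'], ?_⟩
      simp [smul_dotProduct, hdh]
    have h1 : E d₀ ≤ E (‖d‖⁻¹ • d) := hmin hmem
    have h2 : perronForm p h (‖d‖⁻¹ • d) (‖d‖⁻¹ • d) ≤ V₁ := hmax hmem
    rw [hEsmul] at h1
    rw [perronForm_smul_smul] at h2
    have h3 : E d₀ / (V₁ + 1) * (‖d‖⁻¹ * ‖d‖⁻¹ * perronForm p h d d) ≤ ‖d‖⁻¹ ^ 2 * E d := by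
      refine le_trans ?_ h1
      rw [div_mul_eq_mul_div, div_le_iff₀ (by positivity)]
      exact mul_le_mul_of_nonneg_left (h2.trans (by linarith)) hm.le
    have hn2 : (0 : ℝ) < ‖d‖⁻¹ ^ 2 := by positivity
    refine le_of_mul_le_mul_left ?_ hn2
    calc _ = E d₀ / (V₁ + 1) * (‖d‖⁻¹ * ‖d‖⁻¹ * perronForm p h d d) := by ring
      _ ≤ _ := h3

end Lyapunov

/-! ### Deterministic stochastic approximation -/

section Deterministic

/-- A Robbins–Monro recursion: a nonnegative sequence that is contracted at rate `c * α n`, up to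
`o(α n)`, with steps of infinite sum, tends to zero. -/
lemma tendsto_zero_of_le_sub_mul {v α e : ℕ → ℝ} {c : ℝ} (hc : 0 < c) (hv : ∀ n, 0 ≤ v n)
    (hα0 : ∀ n, 0 ≤ α n) (hα : Tendsto α atTop (𝓝 0))
    (hsum : Tendsto (fun n => ∑ k ∈ Finset.range n, α k) atTop atTop)
    (he : Tendsto e atTop (𝓝 0))
    (hstep : ∀ n, v (n + 1) ≤ v n - α n * (c * v n - e n)) :
    Tendsto v atTop (𝓝 0) := by
  rw [tendsto_order]
  refine ⟨fun a ha => Eventually.of_forall fun n => ha.trans_le (hv n), fun ε' hε' => ?_⟩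
  set ε := ε' / 2 with hε
  have hεpos : 0 < ε := by positivity
  have h1 : ∀ᶠ n in atTop, e n ≤ c * ε := he.eventually_le_const (by positivity)
  have h2 : ∀ᶠ n in atTop, α n ≤ c⁻¹ := hα.eventually_le_const (by positivity)
  obtain ⟨N, hN⟩ := eventually_atTop.1 (h1.and h2)
  set B := |v N - ε| with hB
  have key : ∀ k, v (N + k) - ε ≤
      B * Real.exp (-(c * (∑ j ∈ Finset.range (N + k), α j - ∑ j ∈ Finset.range N, α j))) := by
    intro k
    induction k with
    | zero => simpa using le_abs_self (v N - ε)
    | succ k ih =>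
      obtain ⟨hek, hαk⟩ := hN (N + k) (by omega)
      have hcα : c * α (N + k) ≤ 1 := by
        calc c * α (N + k) ≤ c * c⁻¹ := mul_le_mul_of_nonneg_left hαk hc.le
          _ = 1 := mul_inv_cancel₀ hc.ne'
      have hs := hstep (N + k)
      have hexp : 1 - c * α (N + k) ≤ Real.exp (-(c * α (N + k))) := by
        have := Real.add_one_le_exp (-(c * α (N + k)))
        linarith
      rw [← add_assoc, Finset.sum_range_succ]
      set X := ∑ j ∈ Finset.range (N + k), α j - ∑ j ∈ Finset.range N, α j with hX
      calc v (N + k + 1) - ε ≤ (1 - c * α (N + k)) * (v (N + k) - ε) := by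
            nlinarith [mul_le_mul_of_nonneg_left hek (hα0 (N + k))]
        _ ≤ (1 - c * α (N + k)) * (B * Real.exp (-(c * X))) :=
            mul_le_mul_of_nonneg_left ih (by linarith)
        _ ≤ Real.exp (-(c * α (N + k))) * (B * Real.exp (-(c * X))) :=
            mul_le_mul_of_nonneg_right hexp (by positivity)
        _ = B * (Real.exp (-(c * α (N + k))) * Real.exp (-(c * X))) := by ring
        _ = _ := by rw [← Real.exp_add]; congr 2; rw [hX]; ring
  have hlim : Tendsto (fun n =>
      B * Real.exp (-(c * (∑ j ∈ Finset.range n, α j - ∑ j ∈ Finset.range N, α j))))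
      atTop (𝓝 0) := by
    rw [← mul_zero B]
    refine Tendsto.const_mul _ (Real.tendsto_exp_neg_atTop_nhds_zero.comp ?_)
    exact (tendsto_atTop_add_const_right _ _ hsum).const_mul_atTop hc
  filter_upwards [hlim.eventually_lt_const hεpos, eventually_ge_atTop N] with n hn hNn
  obtain ⟨k, rfl⟩ := Nat.exists_eq_add_of_le hNn
  have := key k
  linarith

variable {ι : Type*} [Fintype ι] {A : Matrix ι ι ℝ}

lemma abs_perronForm_le {p h : ι → ℝ} (hp : ∀ i, 0 < p i) (hh : ∀ i, 0 < h i) (a b : ι → ℝ) :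
    |perronForm p h a b| ≤ (∑ i, h i / p i) * (‖a‖ * ‖b‖) := by
  rw [perronForm, Finset.sum_mul]
  refine (Finset.abs_sum_le_sum_abs _ _).trans (Finset.sum_le_sum fun i _ => ?_)
  rw [abs_mul, abs_of_pos (div_pos (hh i) (hp i)), abs_mul]
  exact mul_le_mul_of_nonneg_left (mul_le_mul (norm_le_pi_norm a i) (norm_le_pi_norm b i)
    (abs_nonneg _) (norm_nonneg _)) (div_pos (hh i) (hp i)).le

/-- Perturbed Euler steps for `d' = d A - lam d` on the hyperplane annihilated by `h` converge to
zero, since `perronForm p h d d` is a strict Lyapunov function there. -/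
theorem Matrix.IsIrreducible.tendsto_zero_of_euler [DecidableEq ι] [Nonempty ι]
    (hA : A.IsIrreducible) {lam : ℝ} {p h : ι → ℝ} (hp : ∀ i, 0 < p i) (hh : ∀ i, 0 < h i)
    (hpA : p ᵥ* A = lam • p) (hhA : A *ᵥ h = lam • h) {d η : ℕ → ι → ℝ} {α : ℕ → ℝ} {B : ℝ}
    (hα0 : ∀ n, 0 ≤ α n) (hα : Tendsto α atTop (𝓝 0))
    (hsum : Tendsto (fun n => ∑ k ∈ Finset.range n, α k) atTop atTop)
    (hdh : ∀ n, d n ⬝ᵥ h = 0) (hdB : ∀ n, ‖d n‖ ≤ B) (hη : Tendsto η atTop (𝓝 0))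
    (hstep : ∀ n, d (n + 1) = d n + α n • (d n ᵥ* A - lam • d n + η n)) :
    Tendsto d atTop (𝓝 0) := by
  obtain ⟨c, hc, hcoer⟩ := hA.exists_perronForm_le hp hh hpA hhA
  set Q := ∑ i, h i / p i with hQ
  have hQ0 : 0 ≤ Q := Finset.sum_nonneg fun i _ => (div_pos (hh i) (hp i)).le
  have hB0 : 0 ≤ B := (norm_nonneg _).trans (hdB 0)
  let Λ := LinearMap.toContinuousLinearMap (Matrix.vecMulLinear A - lam • LinearMap.id)
  have hΛ : ∀ x, ‖x ᵥ* A - lam • x‖ ≤ ‖Λ‖ * ‖x‖ := fun x => Λ.le_opNorm x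
  set f : ℕ → ι → ℝ := fun n => d n ᵥ* A - lam • d n + η n with hf
  have hηn : Tendsto (fun n => ‖η n‖) atTop (𝓝 0) := by simpa using hη.norm
  have hfb : ∀ n, ‖f n‖ ≤ ‖Λ‖ * B + ‖η n‖ := fun n =>
    (norm_add_le _ _).trans (by
      gcongr
      exact (hΛ _).trans (mul_le_mul_of_nonneg_left (hdB n) (norm_nonneg _)))
  set e : ℕ → ℝ := fun n =>
    2 * perronForm p h (d n) (η n) + α n * perronForm p h (f n) (f n) with he
  have he0 : Tendsto e atTop (𝓝 0) := by
    have hbnd : Tendsto (fun n => 2 * (Q * (B * ‖η n‖)) +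
        α n * (Q * ((‖Λ‖ * B + ‖η n‖) * (‖Λ‖ * B + ‖η n‖)))) atTop (𝓝 0) := by
      have h1 := ((hηn.const_mul B).const_mul Q).const_mul 2
      have h2 := hα.mul ((((hηn.const_add (‖Λ‖ * B)).mul (hηn.const_add (‖Λ‖ * B)))).const_mul Q)
      simpa using h1.add h2
    refine squeeze_zero_norm (fun n => ?_) hbnd
    rw [he, Real.norm_eq_abs]
    refine (abs_add_le _ _).trans (add_le_add ?_ ?_)
    · rw [abs_mul, abs_two]
      refine mul_le_mul_of_nonneg_left ((abs_perronForm_le hp hh _ _).trans ?_) zero_le_two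
      exact mul_le_mul_of_nonneg_left
        (mul_le_mul_of_nonneg_right (hdB n) (norm_nonneg _)) hQ0
    · rw [abs_mul, abs_of_nonneg (hα0 n)]
      refine mul_le_mul_of_nonneg_left ((abs_perronForm_le hp hh _ _).trans ?_) (hα0 n)
      exact mul_le_mul_of_nonneg_left
        (mul_le_mul (hfb n) (hfb n) (norm_nonneg _) ((norm_nonneg _).trans (hfb n))) hQ0
  have hV : Tendsto (fun n => perronForm p h (d n) (d n)) atTop (𝓝 0) := by
    refine tendsto_zero_of_le_sub_mul (c := 2 * c) (by positivity)
      (fun n => perronForm_self_nonneg hp hh _) hα0 hα hsum he0 fun n => ?_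
    have h1 := hcoer (d n) (hdh n)
    rw [hstep n, perronForm_add_smul, perronForm_add_right p h (d n), he]
    simp only
    nlinarith [mul_le_mul_of_nonneg_left h1 (hα0 n)]
  rw [tendsto_pi_nhds]
  intro i
  rw [Pi.zero_apply, tendsto_zero_iff_abs_tendsto_zero]
  have hsq : Tendsto (fun n => √(p i / h i * perronForm p h (d n) (d n))) atTop (𝓝 0) := by
    simpa using (hV.const_mul (p i / h i)).sqrt
  refine squeeze_zero (fun n => abs_nonneg _) (fun n => ?_) hsq
  refine Real.abs_le_sqrt ?_
  have h1 : h i / p i * (d n i * d n i) ≤ perronForm p h (d n) (d n) :=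
    Finset.single_le_sum (f := fun i => h i / p i * (d n i * d n i))
      (fun j _ => mul_nonneg (div_pos (hh j) (hp j)).le (mul_self_nonneg _)) (Finset.mem_univ i)
  calc d n i ^ 2 = p i / h i * (h i / p i * (d n i * d n i)) := by
        field_simp [(hp i).ne', (hh i).ne']
    _ ≤ _ := mul_le_mul_of_nonneg_left h1 (div_pos (hp i) (hh i)).le

lemma exists_dotProduct_bounds [Nonempty ι] {g : ι → ℝ} (hg : ∀ i, 0 < g i) :
    ∃ lo > 0, ∃ hi, ∀ z ∈ stdSimplex ℝ ι, lo ≤ z ⬝ᵥ g ∧ z ⬝ᵥ g ≤ hi := by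
  obtain ⟨i₀, h₀⟩ := Finite.exists_min g
  obtain ⟨i₁, h₁⟩ := Finite.exists_max g
  refine ⟨g i₀, hg i₀, g i₁, fun z hz => ⟨?_, ?_⟩⟩
  · calc g i₀ = ∑ i, z i * g i₀ := by rw [← Finset.sum_mul, hz.2, one_mul]
      _ ≤ _ := Finset.sum_le_sum fun i _ => mul_le_mul_of_nonneg_left (h₀ i) (hz.1 i)
  · calc z ⬝ᵥ g ≤ ∑ i, z i * g i₁ :=
          Finset.sum_le_sum fun i _ => mul_le_mul_of_nonneg_left (h₁ i) (hz.1 i)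
      _ = g i₁ := by rw [← Finset.sum_mul, hz.2, one_mul]

lemma norm_le_one_of_mem_stdSimplex {z : ι → ℝ} (hz : z ∈ stdSimplex ℝ ι) : ‖z‖ ≤ 1 := by
  refine (pi_norm_le_iff_of_nonneg zero_le_one).2 fun i => ?_
  rw [Real.norm_of_nonneg (hz.1 i), ← hz.2]
  exact Finset.single_le_sum (fun j _ => hz.1 j) (Finset.mem_univ i)

lemma sum_vecMul_eq (z : ι → ℝ) (A : Matrix ι ι ℝ) : ∑ j, (z ᵥ* A) j = z ⬝ᵥ A *ᵥ 1 := by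
  rw [Matrix.dotProduct_mulVec, dotProduct_one]

lemma mulVec_one_pos {lam : ℝ} {h : ι → ℝ} (hA : ∀ i j, 0 ≤ A i j) (hlam : 0 < lam)
    (hh : ∀ i, 0 < h i) (hhA : A *ᵥ h = lam • h) (i : ι) : 0 < (A *ᵥ 1) i := by
  have h0 : 0 ≤ (A *ᵥ 1) i := Finset.sum_nonneg fun j _ => mul_nonneg (hA i j) zero_le_one
  refine lt_of_le_of_ne h0 fun h1 => ?_
  have h2 : ∀ j, A i j = 0 := by
    intro j
    have := (Finset.sum_eq_zero_iff_of_nonneg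
      (fun j _ => mul_nonneg (hA i j) zero_le_one)).1 h1.symm j (Finset.mem_univ _)
    simpa using this
  have h3 := congrFun hhA i
  simp only [Matrix.mulVec, dotProduct, h2, zero_mul, Finset.sum_const_zero, Pi.smul_apply,
    smul_eq_mul] at h3
  exact (mul_pos hlam (hh i)).ne h3

/-- A sequence in the simplex that moves by small steps towards the normalized image `z A / (z A 1)`
of its current position converges to the Perron vector. In the coordinates `w = z / (z ⬝ᵥ h)` these
are Euler steps of a linear equation up to a change of time. -/
theorem Matrix.IsIrreducible.tendsto_perron_of_averaging [DecidableEq ι] [Nonempty ι]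
    (hA : A.IsIrreducible) {lam : ℝ} {p h : ι → ℝ} (hlam : 0 < lam) (hp : ∀ i, 0 < p i)
    (hp1 : ∑ i, p i = 1) (hh : ∀ i, 0 < h i) (hpA : p ᵥ* A = lam • p) (hhA : A *ᵥ h = lam • h)
    {z y : ℕ → ι → ℝ} {a : ℕ → ℝ} (ha0 : ∀ n, 0 ≤ a n) (ha : Tendsto a atTop (𝓝 0))
    (hsum : Tendsto (fun n => ∑ k ∈ Finset.range n, a k) atTop atTop)
    (hz : ∀ n, z n ∈ stdSimplex ℝ ι) (hstep : ∀ n, z (n + 1) = z n + a n • (y n - z n))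
    (hy : Tendsto (fun n => y n - (z n ⬝ᵥ A *ᵥ 1)⁻¹ • z n ᵥ* A) atTop (𝓝 0)) :
    Tendsto z atTop (𝓝 p) := by
  obtain ⟨hlo, hlo0, hhi, hD⟩ := exists_dotProduct_bounds hh
  obtain ⟨slo, slo0, shi, hS⟩ := exists_dotProduct_bounds (mulVec_one_pos hA.nonneg hlam hh hhA)
  set D : ℕ → ℝ := fun n => z n ⬝ᵥ h with hDdef
  set s : ℕ → ℝ := fun n => z n ⬝ᵥ A *ᵥ 1 with hsdef
  have hD' : ∀ n, hlo ≤ D n ∧ D n ≤ hhi := fun n => hD _ (hz n)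
  have hS' : ∀ n, slo ≤ s n ∧ s n ≤ shi := fun n => hS _ (hz n)
  have hDpos : ∀ n, 0 < D n := fun n => hlo0.trans_le (hD' n).1
  have hspos : ∀ n, 0 < s n := fun n => slo0.trans_le (hS' n).1
  have hhi0 : 0 < hhi := (hDpos 0).trans_le (hD' 0).2
  have shi0 : 0 < shi := (hspos 0).trans_le (hS' 0).2
  set δ : ℕ → ι → ℝ := fun n => y n - (s n)⁻¹ • z n ᵥ* A with hδ
  set w : ℕ → ι → ℝ := fun n => (D n)⁻¹ • z n with hw
  have hzw : ∀ n, z n = D n • w n := fun n => by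
    rw [hw]; simp only; rw [smul_smul, mul_inv_cancel₀ (hDpos n).ne', one_smul]
  have hph : 0 < p ⬝ᵥ h :=
    Finset.sum_pos (fun i _ => mul_pos (hp i) (hh i)) Finset.univ_nonempty
  set p' : ι → ℝ := (p ⬝ᵥ h)⁻¹ • p with hp'
  have hp'A : p' ᵥ* A = lam • p' := by
    rw [hp', Matrix.smul_vecMul, hpA, smul_comm]
  have hwB : ∀ n, ‖w n‖ ≤ hlo⁻¹ := fun n => by
    rw [hw]; simp only
    rw [norm_smul, norm_inv, Real.norm_of_nonneg (hDpos n).le]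
    calc (D n)⁻¹ * ‖z n‖ ≤ hlo⁻¹ * 1 :=
          mul_le_mul (inv_anti₀ hlo0 (hD' n).1) (norm_le_one_of_mem_stdSimplex (hz n))
            (norm_nonneg _) (inv_pos.2 hlo0).le
      _ = _ := mul_one _
  have hDstep : ∀ n, D (n + 1) = D n + a n * ((s n)⁻¹ * (lam * D n) + δ n ⬝ᵥ h - D n) := by
    intro n
    have hyd : y n = (s n)⁻¹ • z n ᵥ* A + δ n := by rw [hδ]; simp
    simp only [hDdef]
    rw [hstep n, hyd, add_dotProduct, smul_dotProduct, sub_dotProduct, add_dotProduct,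
      smul_dotProduct, ← Matrix.dotProduct_mulVec, hhA, dotProduct_smul]
    simp only [smul_eq_mul]
  set α : ℕ → ℝ := fun n => a n * (D n / (D (n + 1) * s n)) with hα
  set η : ℕ → ι → ℝ := fun n => (s n / D n) • (δ n - (δ n ⬝ᵥ h) • w n) with hη
  have hd : Tendsto (fun n => w n - p') atTop (𝓝 0) := by
    refine hA.tendsto_zero_of_euler hp hh hpA hhA (α := α) (η := η) (B := hlo⁻¹ + ‖p'‖)
      ?_ ?_ ?_ ?_ ?_ ?_ ?_
    · exact fun n => mul_nonneg (ha0 n)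
        (div_nonneg (hDpos n).le (mul_pos (hDpos _) (hspos n)).le)
    · have : Tendsto (fun n => a n * (hhi / (hlo * slo))) atTop (𝓝 0) := by
        simpa using ha.mul_const (hhi / (hlo * slo))
      refine squeeze_zero (fun n => mul_nonneg (ha0 n)
        (div_nonneg (hDpos n).le (mul_pos (hDpos _) (hspos n)).le)) (fun n => ?_) this
      refine mul_le_mul_of_nonneg_left ?_ (ha0 n)
      exact div_le_div₀ hhi0.le (hD' n).2 (by positivity)
        (mul_le_mul (hD' _).1 (hS' n).1 slo0.le (hDpos _).le)
    · have h1 : Tendsto (fun n => (hlo / (hhi * shi)) * ∑ k ∈ Finset.range n, a k) atTop atTop :=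
        hsum.const_mul_atTop (by positivity)
      refine tendsto_atTop_mono (fun n => ?_) h1
      rw [Finset.mul_sum]
      refine Finset.sum_le_sum fun k _ => ?_
      rw [mul_comm]
      refine mul_le_mul_of_nonneg_left ?_ (ha0 k)
      exact div_le_div₀ (hDpos k).le (hD' k).1 (mul_pos (hDpos _) (hspos k))
        (mul_le_mul (hD' _).2 (hS' k).2 (hspos k).le hhi0.le)
    · intro n
      rw [hw, hp', sub_dotProduct, smul_dotProduct, smul_dotProduct, smul_eq_mul, smul_eq_mul,
        inv_mul_cancel₀ hph.ne', sub_eq_zero]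
      exact inv_mul_cancel₀ (hDpos n).ne'
    · exact fun n => (norm_sub_le _ _).trans (add_le_add (hwB n) le_rfl)
    · have hδn : Tendsto (fun n => ‖δ n‖) atTop (𝓝 0) := by simpa using hy.norm
      have hδh : Tendsto (fun n => |δ n ⬝ᵥ h|) atTop (𝓝 0) := by
        have hcont : Continuous fun v : ι → ℝ => |v ⬝ᵥ h| := by
          simp only [dotProduct]; fun_prop
        simpa [Function.comp_def] using (hcont.tendsto 0).comp hy
      have hbnd : Tendsto (fun n => shi / hlo * (‖δ n‖ + |δ n ⬝ᵥ h| * hlo⁻¹)) atTop (𝓝 0) := by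
        simpa using (hδn.add (hδh.mul_const hlo⁻¹)).const_mul (shi / hlo)
      refine squeeze_zero_norm (fun n => ?_) hbnd
      rw [hη, norm_smul, Real.norm_of_nonneg (div_pos (hspos n) (hDpos n)).le]
      refine mul_le_mul (div_le_div₀ shi0.le (hS' n).2 hlo0 (hD' n).1) ?_ (norm_nonneg _)
        (by positivity)
      refine (norm_sub_le _ _).trans (add_le_add le_rfl ?_)
      rw [norm_smul, Real.norm_eq_abs]
      exact mul_le_mul_of_nonneg_left (hwB n) (abs_nonneg _)
    · intro n
      have hyd : y n = (s n)⁻¹ • z n ᵥ* A + δ n := by rw [hδ]; simp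
      have hlin : (w n - p') ᵥ* A - lam • (w n - p') = w n ᵥ* A - lam • w n := by
        rw [Matrix.sub_vecMul, hp'A, smul_sub]; abel
      rw [hlin, sub_add_eq_add_sub, sub_left_inj]
      have hinj : D (n + 1) • w (n + 1) =
          D (n + 1) • (w n + α n • (w n ᵥ* A - lam • w n + η n)) := by
        have hDn := (hDpos n).ne'
        have hsn := (hspos n).ne'
        have hDn1 := (hDpos (n + 1)).ne'
        have hαn : D (n + 1) * α n = a n * (D n / s n) := by
          rw [hα]; field_simp
        ext i
        have e1 : z n i = D n * w n i := congrFun (hzw n) i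
        have e2 : (z n ᵥ* A) i = D n * (w n ᵥ* A) i := by
          conv_lhs => rw [hzw n, Matrix.smul_vecMul]
          rfl
        have e3 : D (n + 1) * α n * η n i = a n * (δ n i - δ n ⬝ᵥ h * w n i) := by
          rw [hαn, hη]
          simp only [Pi.smul_apply, Pi.sub_apply, smul_eq_mul]
          field_simp
        rw [← hzw, hstep n, hyd]
        simp only [Pi.add_apply, Pi.smul_apply, Pi.sub_apply, smul_eq_mul]
        linear_combination (1 - a n) * e1 + a n * (s n)⁻¹ * e2 - w n i * hDstep n -
          ((w n ᵥ* A) i - lam * w n i) * hαn - e3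
      exact smul_right_injective _ (hDpos (n + 1)).ne' hinj
  have hwlim : Tendsto w atTop (𝓝 p') := by
    simpa using hd.add_const p'
  have hw1 : ∀ n, ∑ i, w n i = (D n)⁻¹ := fun n => by
    simp only [hw, Pi.smul_apply, smul_eq_mul, ← Finset.mul_sum, (hz n).2, mul_one]
  have hp'1 : ∑ i, p' i = (p ⬝ᵥ h)⁻¹ := by
    simp only [hp', Pi.smul_apply, smul_eq_mul, ← Finset.mul_sum, hp1, mul_one]
  have hcont : Tendsto (fun n => (∑ i, w n i)⁻¹ • w n) atTop (𝓝 ((∑ i, p' i)⁻¹ • p')) := by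
    refine Tendsto.smul (Tendsto.inv₀ (tendsto_finsetSum _ fun i _ =>
      (tendsto_pi_nhds.1 hwlim i)) ?_) hwlim
    rw [hp'1]
    exact (inv_pos.2 hph).ne'
  have he1 : (∑ i, p' i)⁻¹ • p' = p := by
    rw [hp'1, hp', smul_smul, inv_inv, mul_inv_cancel₀ hph.ne', one_smul]
  rw [he1] at hcont
  refine hcont.congr fun n => ?_
  rw [hw1, inv_inv, ← hzw]

/-- The deterministic form of the urn theorem: if the compositions `C n` are, up to `o(n)`, the
images under `A` of the accumulated proportions, then the averaged proportions converge. -/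
theorem Matrix.IsIrreducible.tendsto_average_proportions [DecidableEq ι] [Nonempty ι]
    (hA : A.IsIrreducible) {lam : ℝ} {p h : ι → ℝ} (hlam : 0 < lam) (hp : ∀ i, 0 < p i)
    (hp1 : ∑ i, p i = 1) (hh : ∀ i, 0 < h i) (hpA : p ᵥ* A = lam • p) (hhA : A *ᵥ h = lam • h)
    {C : ℕ → ι → ℝ} (hC : ∀ n i, 0 ≤ C n i) (hS : ∀ n, 0 < ∑ i, C n i)
    (hlim : Tendsto (fun n : ℕ => (n : ℝ)⁻¹ • C n -
      ((n : ℝ)⁻¹ • ∑ k ∈ Finset.range n, (∑ i, C k i)⁻¹ • C k) ᵥ* A) atTop (𝓝 0)) :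
    Tendsto (fun n : ℕ => (n : ℝ)⁻¹ • ∑ k ∈ Finset.range n, (∑ i, C k i)⁻¹ • C k)
      atTop (𝓝 p) := by
  obtain ⟨slo, slo0, shi, hsb⟩ := exists_dotProduct_bounds (mulVec_one_pos hA.nonneg hlam hh hhA)
  set x : ℕ → ι → ℝ := fun k => (∑ i, C k i)⁻¹ • C k with hx
  set z : ℕ → ι → ℝ := fun n => (n : ℝ)⁻¹ • ∑ k ∈ Finset.range n, x k with hzdef
  have hxs : ∀ n, x n ∈ stdSimplex ℝ ι := fun n => by
    refine ⟨fun i => mul_nonneg (inv_pos.2 (hS n)).le (hC n i), ?_⟩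
    simp only [hx, Pi.smul_apply, smul_eq_mul, ← Finset.mul_sum]
    exact inv_mul_cancel₀ (hS n).ne'
  have hzs : ∀ n, z (n + 1) ∈ stdSimplex ℝ ι := fun n => by
    have hn : (0 : ℝ) < ((n + 1 : ℕ) : ℝ) := by positivity
    refine ⟨fun i => ?_, ?_⟩
    · simp only [hzdef, Pi.smul_apply, Finset.sum_apply, smul_eq_mul]
      exact mul_nonneg (inv_pos.2 hn).le (Finset.sum_nonneg fun k _ => (hxs k).1 i)
    · simp only [hzdef, Pi.smul_apply, Finset.sum_apply, smul_eq_mul, ← Finset.mul_sum]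
      rw [Finset.sum_comm]
      simp only [(hxs _).2, Finset.sum_const, Finset.card_range, nsmul_eq_mul, mul_one]
      exact inv_mul_cancel₀ hn.ne'
  rw [← tendsto_add_atTop_iff_nat 1]
  refine hA.tendsto_perron_of_averaging hlam hp hp1 hh hpA hhA (z := fun n => z (n + 1))
    (y := fun n => x (n + 1)) (a := fun n => 1 / ((n : ℝ) + 2)) (fun n => by positivity) ?_ ?_
    hzs ?_ ?_
  · have := (tendsto_add_atTop_iff_nat 1).2 (tendsto_one_div_add_atTop_nhds_zero_nat (𝕜 := ℝ))
    refine this.congr fun n => ?_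
    push_cast
    ring
  · have h1 := (tendsto_add_atTop_iff_nat 1).2 Real.tendsto_sum_range_one_div_nat_succ_atTop
    have h2 := tendsto_atTop_add_const_right _ (-1 : ℝ) h1
    refine h2.congr fun n => ?_
    rw [Finset.sum_range_succ']
    simp only [Nat.cast_zero, zero_add, div_one, add_neg_cancel_right]
    refine Finset.sum_congr rfl fun k _ => ?_
    push_cast
    ring
  · intro n
    have hn1 : ((n : ℝ) + 1) ≠ 0 := by positivity
    have hn2 : ((n : ℝ) + 2) ≠ 0 := by positivity
    simp only [hzdef]
    rw [Finset.sum_range_succ _ (n + 1)]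
    ext i
    simp only [Pi.add_apply, Pi.smul_apply, Pi.sub_apply, smul_eq_mul]
    push_cast
    rw [show (n : ℝ) + 1 + 1 = n + 2 by ring]
    field_simp
    ring
  · set ε : ℕ → ι → ℝ := fun n => (n : ℝ)⁻¹ • C n - z n ᵥ* A with hε
    have hlim' : Tendsto (fun n => ε (n + 1)) atTop (𝓝 0) := (tendsto_add_atTop_iff_nat 1).2 hlim
    have hεn : Tendsto (fun n => ‖ε (n + 1)‖) atTop (𝓝 0) := by simpa using hlim'.norm
    have hε1 : Tendsto (fun n => |∑ i, ε (n + 1) i|) atTop (𝓝 0) := by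
      have hcont : Continuous fun v : ι → ℝ => |∑ i, v i| := by fun_prop
      simpa [Function.comp_def] using (hcont.tendsto 0).comp hlim'
    have hbnd : Tendsto (fun n => slo⁻¹ * (‖ε (n + 1)‖ + |∑ i, ε (n + 1) i| * 1)) atTop (𝓝 0) := by
      simpa using (hεn.add (hε1.mul_const 1)).const_mul slo⁻¹
    refine squeeze_zero_norm (fun n => ?_) hbnd
    set m := n + 1 with hm
    set s := z m ⬝ᵥ A *ᵥ 1 with hs
    have hs0 : slo ≤ s := (hsb _ (hzs n)).1
    have hspos : 0 < s := slo0.trans_le hs0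
    have hκ : (m : ℝ)⁻¹ • C m = z m ᵥ* A + ε m := by rw [hε]; simp
    -- the total content divided by `m` is `s + ∑ ε`, so `(s + ∑ ε) x = z A + ε`
    have hσ : (m : ℝ)⁻¹ * ∑ i, C m i = s + ∑ i, ε m i := by
      have := congrArg (fun v : ι → ℝ => ∑ i, v i) hκ
      simp only [Pi.smul_apply, smul_eq_mul, ← Finset.mul_sum, Pi.add_apply,
        Finset.sum_add_distrib, sum_vecMul_eq] at this
      exact this
    have hxm : (s + ∑ i, ε m i) • x m = z m ᵥ* A + ε m := by
      rw [← hσ, ← hκ, hx]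
      simp only
      rw [smul_smul, mul_assoc, mul_inv_cancel₀ (hS m).ne', mul_one]
    have hdiff : x m - s⁻¹ • z m ᵥ* A = s⁻¹ • (ε m - (∑ i, ε m i) • x m) := by
      have h1 : z m ᵥ* A = (s + ∑ i, ε m i) • x m - ε m := by rw [hxm]; simp
      rw [h1]
      ext i
      simp only [Pi.smul_apply, Pi.sub_apply, smul_eq_mul]
      field_simp
      ring
    rw [hdiff, norm_smul, norm_inv, Real.norm_of_nonneg hspos.le]
    refine mul_le_mul (inv_anti₀ slo0 hs0) ?_ (norm_nonneg _) (inv_pos.2 slo0).le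
    refine (norm_sub_le _ _).trans (add_le_add le_rfl ?_)
    rw [norm_smul, Real.norm_eq_abs]
    exact mul_le_mul_of_nonneg_left (norm_le_one_of_mem_stdSimplex (hxs m)) (abs_nonneg _)

end Deterministic

/-! ### The past of a sequence -/

section Past

variable {β : Type*} [Zero β]

/-- The sequence `x` with all terms from index `n` on replaced by zero: the past of `x` at time `n`,
kept in a type that does not depend on `n`. -/
def truncSeq (n : ℕ) (x : ℕ → β) : ℕ → β := fun k => if k < n then x k else 0

lemma truncSeq_truncSeq {k l : ℕ} (h : k ≤ l) (x : ℕ → β) :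
    truncSeq k (truncSeq l x) = truncSeq k x := by
  funext j
  simp only [truncSeq]
  split_ifs <;> first | rfl | omega

lemma truncSeq_apply {k n : ℕ} (h : k < n) (x : ℕ → β) : truncSeq n x k = x k :=
  if_pos h

variable [MeasurableSpace β]

lemma measurable_truncSeq (n : ℕ) : Measurable (truncSeq n : (ℕ → β) → ℕ → β) := by
  refine measurable_pi_iff.2 fun k => ?_
  by_cases hk : k < n
  · simp only [truncSeq, hk, if_true]; exact measurable_pi_apply k
  · simp only [truncSeq, hk, if_false]; exact measurable_const

lemma ProbabilityTheory.iIndepFun.indepFun_truncSeq {Ω : Type*} [MeasurableSpace Ω]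
    {μ : Measure Ω} {V : ℕ → Ω → β} (hV : iIndepFun V μ)
    (hm : ∀ n, Measurable (V n)) (n : ℕ) :
    IndepFun (fun ω => truncSeq n fun k => V k ω) (V n) μ := by
  have h := hV.indepFun_finset (Finset.range n) {n} (by simp) hm
  let φ : (Finset.range n → β) → ℕ → β := fun g k =>
    if hk : k ∈ Finset.range n then g ⟨k, hk⟩ else 0
  have hφ : Measurable φ := by
    refine measurable_pi_iff.2 fun k => ?_
    by_cases hk : k ∈ Finset.range n
    · simp only [φ, hk, dite_true]; exact measurable_pi_apply _
    · simp only [φ, hk, dite_false]; exact measurable_const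
  have h2 := h.comp hφ (measurable_pi_apply (⟨n, Finset.mem_singleton_self n⟩ : ({n} : Finset ℕ)))
  refine h2.congr (Eventually.of_forall fun ω => ?_) (Eventually.of_forall fun ω => rfl)
  funext k
  by_cases hk : k < n <;> simp [φ, truncSeq, hk]

end Past

/-! ### Averages of bounded orthogonal random variables -/

section Orthogonal

/-- Between consecutive squares a sequence with bounded increments moves by at most `O(√n)`, so
convergence of the averages along the squares suffices. -/
lemma tendsto_div_of_tendsto_div_sq {M : ℕ → ℝ} {B : ℝ} (hM : ∀ n, |M (n + 1) - M n| ≤ B)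
    (h : Tendsto (fun m : ℕ => M (m ^ 2) / (m ^ 2 : ℕ)) atTop (𝓝 0)) :
    Tendsto (fun n : ℕ => M n / n) atTop (𝓝 0) := by
  have hB : 0 ≤ B := (abs_nonneg _).trans (hM 0)
  have hinc : ∀ n k, |M (n + k) - M n| ≤ k * B := by
    intro n k
    induction k with
    | zero => simp
    | succ k ih =>
      calc |M (n + (k + 1)) - M n| = |(M (n + k + 1) - M (n + k)) + (M (n + k) - M n)| := by
            rw [← add_assoc]; congr 1; ring
        _ ≤ B + k * B := (abs_add_le _ _).trans (add_le_add (hM _) ih)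
        _ = _ := by push_cast; ring
  have hsqrt : Tendsto Nat.sqrt atTop atTop := by
    refine tendsto_atTop.2 fun b => ?_
    filter_upwards [eventually_ge_atTop (b * b)] with n hn
    exact Nat.le_sqrt.2 hn
  have h1 : Tendsto (fun m : ℕ => |M (m ^ 2) / (m ^ 2 : ℕ)| + 2 * B * (1 / (m : ℝ)))
      atTop (𝓝 0) := by
    simpa using h.abs.add (tendsto_one_div_atTop_nhds_zero_nat.const_mul (2 * B))
  refine squeeze_zero_norm' ?_ (h1.comp hsqrt)
  filter_upwards [eventually_ge_atTop 1] with n hn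
  set m := Nat.sqrt n with hm
  have hm1 : 1 ≤ m := Nat.le_sqrt.2 (by simpa using hn)
  have hmn : m ^ 2 ≤ n := by rw [pow_two]; exact Nat.sqrt_le n
  have hnm : n - m ^ 2 ≤ 2 * m := by
    have := Nat.sqrt_le_add n
    rw [← hm] at this
    rw [pow_two]
    omega
  have hmR : (0 : ℝ) < m := by exact_mod_cast hm1
  have hmR2 : (0 : ℝ) < ((m ^ 2 : ℕ) : ℝ) := by positivity
  have hle : ((m ^ 2 : ℕ) : ℝ) ≤ n := by exact_mod_cast hmn
  have hdiff : |M n - M (m ^ 2)| ≤ 2 * m * B := by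
    have := hinc (m ^ 2) (n - m ^ 2)
    rw [Nat.add_sub_cancel' hmn] at this
    refine this.trans (mul_le_mul_of_nonneg_right ?_ hB)
    exact_mod_cast hnm
  have habs : |M n| ≤ |M (m ^ 2)| + 2 * m * B := by
    have := abs_sub_abs_le_abs_sub (M n) (M (m ^ 2))
    linarith
  simp only [Function.comp_apply, Real.norm_eq_abs]
  rw [abs_div, abs_div, Nat.abs_cast, Nat.abs_cast]
  calc |M n| / n ≤ (|M (m ^ 2)| + 2 * m * B) / (m ^ 2 : ℕ) :=
        div_le_div₀ (by positivity) habs hmR2 hle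
    _ = |M (m ^ 2)| / (m ^ 2 : ℕ) + 2 * B * (1 / m) := by
        rw [add_div]; congr 1; push_cast; field_simp

variable {Ω : Type*} [MeasurableSpace Ω] {μ : Measure Ω} [IsProbabilityMeasure μ]

lemma integrable_of_abs_le {f : Ω → ℝ} (hf : Measurable f) {B : ℝ} (hB : ∀ ω, |f ω| ≤ B) :
    Integrable f μ :=
  Integrable.of_bound hf.aestronglyMeasurable B (Eventually.of_forall hB)

/-- A strong law for bounded orthogonal variables: the second moments of the averages are summable
along the squares. -/
theorem tendsto_average_of_orthogonal {d : ℕ → Ω → ℝ} (hd : ∀ n, Measurable (d n)) {B : ℝ}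
    (hB : ∀ n ω, |d n ω| ≤ B) (horth : ∀ k l, k < l → ∫ ω, d k ω * d l ω ∂μ = 0) :
    ∀ᵐ ω ∂μ, Tendsto (fun n : ℕ => (∑ k ∈ Finset.range n, d k ω) / n) atTop (𝓝 0) := by
  set M : ℕ → Ω → ℝ := fun n ω => ∑ k ∈ Finset.range n, d k ω with hM
  have hMm : ∀ n, Measurable (M n) := fun n => Finset.measurable_fun_sum _ fun k _ => hd k
  have hMB : ∀ n ω, |M n ω| ≤ n * B := fun n ω => by
    refine (Finset.abs_sum_le_sum_abs _ _).trans ?_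
    calc ∑ k ∈ Finset.range n, |d k ω| ≤ ∑ k ∈ Finset.range n, B :=
          Finset.sum_le_sum fun k _ => hB k ω
      _ = n * B := by simp
  have hint2 : ∀ {f g : Ω → ℝ} {a b : ℝ}, Measurable f → Measurable g → (∀ ω, |f ω| ≤ a) →
      (∀ ω, |g ω| ≤ b) → Integrable (fun ω => f ω * g ω) μ := by
    intro f g a b hf hg ha hb
    refine integrable_of_abs_le (B := a * b) (hf.mul hg) fun ω => ?_
    rw [abs_mul]
    exact mul_le_mul (ha ω) (hb ω) (abs_nonneg _) ((abs_nonneg _).trans (ha ω))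
  have hmom : ∀ n, ∫ ω, M n ω ^ 2 ∂μ ≤ n * B ^ 2 := by
    intro n
    induction n with
    | zero => simp [hM]
    | succ n ih =>
      have hcross : ∫ ω, M n ω * d n ω ∂μ = 0 := by
        simp only [hM, Finset.sum_mul]
        rw [integral_finsetSum _ fun k _ => hint2 (hd k) (hd n) (hB k) (hB n)]
        exact Finset.sum_eq_zero fun k hk => horth k n (Finset.mem_range.1 hk)
      have hsplit : (fun ω => M (n + 1) ω ^ 2) =
          fun ω => M n ω * M n ω + 2 * (M n ω * d n ω) + d n ω * d n ω := by
        funext ω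
        simp only [hM, Finset.sum_range_succ]
        ring
      have i1 := hint2 (hMm n) (hMm n) (hMB n) (hMB n)
      have i2 := (hint2 (hMm n) (hd n) (hMB n) (hB n)).const_mul 2
      have i3 := hint2 (hd n) (hd n) (hB n) (hB n)
      rw [hsplit, integral_add (f := fun ω => M n ω * M n ω + 2 * (M n ω * d n ω)) (i1.add i2) i3,
        integral_add i1 i2, integral_const_mul, hcross]
      have hdd : ∫ ω, d n ω * d n ω ∂μ ≤ B ^ 2 := by
        calc ∫ ω, d n ω * d n ω ∂μ ≤ ∫ _, B ^ 2 ∂μ := by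
              refine integral_mono i3 (integrable_const _) fun ω => ?_
              simp only
              rw [← sq, ← sq_abs]
              exact pow_le_pow_left₀ (abs_nonneg _) (hB n ω) 2
          _ = B ^ 2 := by simp
      have : ∫ ω, M n ω * M n ω ∂μ = ∫ ω, M n ω ^ 2 ∂μ := by simp only [sq]
      rw [this]
      push_cast
      linarith
  have hsum : ∀ᵐ ω ∂μ, Tendsto (fun m : ℕ => M (m ^ 2) ω / (m ^ 2 : ℕ)) atTop (𝓝 0) := by
    set g : ℕ → Ω → ENNReal := fun m ω => ENNReal.ofReal ((M (m ^ 2) ω / (m ^ 2 : ℕ)) ^ 2) with hg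
    have hgm : ∀ m, Measurable (g m) := fun m =>
      (((hMm _).div_const _).pow_const 2).ennreal_ofReal
    have hgi : ∀ m, ∫⁻ ω, g m ω ∂μ ≤ ENNReal.ofReal (B ^ 2 * (1 / (m : ℝ) ^ 2)) := by
      intro m
      have hi : Integrable (fun ω => (M (m ^ 2) ω / (m ^ 2 : ℕ)) ^ 2) μ := by
        have := (hint2 (hMm (m ^ 2)) (hMm (m ^ 2)) (hMB _) (hMB _)).div_const
          (((m ^ 2 : ℕ) : ℝ) ^ 2)
        refine this.congr (Eventually.of_forall fun ω => ?_)
        simp only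
        ring
      rw [hg, ← ofReal_integral_eq_lintegral_ofReal hi (Eventually.of_forall fun _ => sq_nonneg _)]
      refine ENNReal.ofReal_le_ofReal ?_
      simp only [div_pow]
      rw [integral_div]
      rcases Nat.eq_zero_or_pos m with rfl | hm
      · simp
      have hmR : (0 : ℝ) < m := by exact_mod_cast hm
      rw [div_le_iff₀ (by positivity)]
      refine (hmom _).trans (le_of_eq ?_)
      push_cast
      field_simp
    have htsum : ∫⁻ ω, ∑' m, g m ω ∂μ ≠ ⊤ := by
      rw [lintegral_tsum fun m => (hgm m).aemeasurable]
      refine ne_top_of_le_ne_top ?_ (ENNReal.tsum_le_tsum hgi)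
      have hs : Summable fun m : ℕ => B ^ 2 * (1 / (m : ℝ) ^ 2) :=
        (Real.summable_one_div_nat_pow.2 one_lt_two).mul_left _
      rw [← ENNReal.ofReal_tsum_of_nonneg (fun m => by positivity) hs]
      exact ENNReal.ofReal_ne_top
    filter_upwards [ae_lt_top (Measurable.tsum hgm) htsum] with ω hω
    have h0 := ENNReal.tendsto_atTop_zero_of_tsum_ne_top hω.ne
    have h1 : Tendsto (fun m : ℕ => (M (m ^ 2) ω / (m ^ 2 : ℕ)) ^ 2) atTop (𝓝 0) := by
      have := (ENNReal.tendsto_toReal ENNReal.zero_ne_top).comp h0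
      refine this.congr fun m => ?_
      simp only [hg, Function.comp_apply]
      exact ENNReal.toReal_ofReal (sq_nonneg _)
    rw [tendsto_zero_iff_abs_tendsto_zero]
    have h2 := h1.sqrt
    rw [Real.sqrt_zero] at h2
    exact h2.congr fun m => Real.sqrt_sq_eq_abs _
  filter_upwards [hsum] with ω hω
  refine tendsto_div_of_tendsto_div_sq (M := fun n => M n ω) (B := B) (fun n => ?_) hω
  simp only [hM, Finset.sum_range_succ, add_sub_cancel_left]
  exact hB n ω

variable {α β γ : Type*} [MeasurableSpace α] [MeasurableSpace β] [MeasurableSpace γ]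

/-- Averages of bounded functionals `H k (Z k, V k)`, centred by integrating out an innovation `V k`
that is independent of the past `Z k`, tend to zero almost surely. -/
theorem tendsto_average_centred_of_indepFun {Z : ℕ → Ω → α} {V : ℕ → Ω → γ}
    (hZ : ∀ n, Measurable (Z n)) (hV : ∀ n, Measurable (V n))
    (hind : ∀ n, IndepFun (Z n) (V n) μ)
    (hpast : ∀ k l, k < l → ∃ φ : α → α × γ, Measurable φ ∧ ∀ ω, (Z k ω, V k ω) = φ (Z l ω))
    {H : ℕ → α × γ → ℝ} (hH : ∀ n, Measurable (H n)) {B : ℝ} (hB : ∀ n q, |H n q| ≤ B) :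
    ∀ᵐ ω ∂μ, Tendsto (fun n : ℕ => (∑ k ∈ Finset.range n,
      (H k (Z k ω, V k ω) - ∫ ω', H k (Z k ω, V k ω') ∂μ)) / n) atTop (𝓝 0) := by
  have hprob : ∀ n, IsProbabilityMeasure (μ.map (V n)) := fun n =>
    Measure.isProbabilityMeasure_map (hV n).aemeasurable
  have hprobZ : ∀ n, IsProbabilityMeasure (μ.map (Z n)) := fun n =>
    Measure.isProbabilityMeasure_map (hZ n).aemeasurable
  have hB0 : ∀ (_ : α × γ), 0 ≤ B := fun q => (abs_nonneg _).trans (hB 0 q)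
  set D : ℕ → α × γ → ℝ := fun n q => H n q - ∫ v, H n (q.1, v) ∂(μ.map (V n)) with hD
  have hDm : ∀ n, Measurable (D n) := fun n =>
    (hH n).sub (((hH n).stronglyMeasurable.integral_prod_right' (ν := μ.map (V n))).measurable.comp
      measurable_fst)
  have hDB : ∀ n q, |D n q| ≤ 2 * B := by
    intro n q
    have h1 : |∫ v, H n (q.1, v) ∂(μ.map (V n))| ≤ B := by
      have := norm_integral_le_of_norm_le_const (μ := μ.map (V n))
        (f := fun v => H n (q.1, v)) (C := B) (Eventually.of_forall fun v => hB n (q.1, v))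
      simpa using this
    calc |D n q| ≤ |H n q| + |∫ v, H n (q.1, v) ∂(μ.map (V n))| := abs_sub _ _
      _ ≤ B + B := add_le_add (hB n q) h1
      _ = 2 * B := by ring
  have hDzero : ∀ n z, ∫ v, D n (z, v) ∂(μ.map (V n)) = 0 := by
    intro n z
    have hi : Integrable (fun v => H n (z, v)) (μ.map (V n)) :=
      integrable_of_abs_le ((hH n).comp measurable_prodMk_left) fun v => hB n (z, v)
    simp only [hD]
    rw [integral_sub hi (integrable_const _)]
    simp
  have hmain := tendsto_average_of_orthogonal (μ := μ) (d := fun n ω => D n (Z n ω, V n ω))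
    (fun n => (hDm n).comp ((hZ n).prodMk (hV n))) (B := 2 * B) (fun n ω => hDB n _) ?_
  · filter_upwards [hmain] with ω hω
    refine hω.congr fun n => ?_
    congr 1
    refine Finset.sum_congr rfl fun k _ => ?_
    simp only [hD]
    rw [integral_map (f := fun v => H k (Z k ω, v)) (hV k).aemeasurable
      ((hH k).comp measurable_prodMk_left).aestronglyMeasurable]
  · intro k l hkl
    obtain ⟨φ, hφ, hφe⟩ := hpast k l hkl
    have hG : Measurable fun q : α × γ => D k (φ q.1) * D l q :=
      ((hDm k).comp (hφ.comp measurable_fst)).mul (hDm l)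
    have hGB : ∀ q : α × γ, |D k (φ q.1) * D l q| ≤ 2 * B * (2 * B) := fun q => by
      rw [abs_mul]
      exact mul_le_mul (hDB _ _) (hDB _ _) (abs_nonneg _) (by linarith [hB0 q])
    calc ∫ ω, D k (Z k ω, V k ω) * D l (Z l ω, V l ω) ∂μ
        = ∫ ω, (fun q : α × γ => D k (φ q.1) * D l q) (Z l ω, V l ω) ∂μ := by
          simp only [hφe]
      _ = ∫ q, D k (φ q.1) * D l q ∂((μ.map (Z l)).prod (μ.map (V l))) := by
          rw [← (indepFun_iff_map_prod_eq_prod_map_map (hZ l).aemeasurable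
            (hV l).aemeasurable).1 (hind l), integral_map ((hZ l).prodMk (hV l)).aemeasurable
            hG.aestronglyMeasurable]
      _ = ∫ z, ∫ v, D k (φ z) * D l (z, v) ∂(μ.map (V l)) ∂(μ.map (Z l)) :=
          integral_prod _ (integrable_of_abs_le hG hGB)
      _ = 0 := by simp only [integral_const_mul, hDzero, mul_zero, integral_zero]

lemma ProbabilityTheory.IndepFun.prodMk_left_of_prodMk_right {X : Ω → α} {Y : Ω → β} {Z : Ω → γ}
    (hX : Measurable X) (hY : Measurable Y) (hZ : Measurable Z)
    (h : IndepFun X (fun ω => (Y ω, Z ω)) μ) (hYZ : IndepFun Y Z μ) :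
    IndepFun (fun ω => (X ω, Y ω)) Z μ := by
  have hXY : IndepFun X Y μ := h.comp measurable_id measurable_fst
  rw [indepFun_iff_map_prod_eq_prod_map_map (hX.prodMk hY).aemeasurable hZ.aemeasurable,
    (indepFun_iff_map_prod_eq_prod_map_map hX.aemeasurable hY.aemeasurable).1 hXY]
  have := Measure.isProbabilityMeasure_map (μ := μ) hX.aemeasurable
  have := Measure.isProbabilityMeasure_map (μ := μ) hY.aemeasurable
  have := Measure.isProbabilityMeasure_map (μ := μ) hZ.aemeasurable
  refine (MeasurableEquiv.prodAssoc (α := α) (β := β) (γ := γ)).map_measurableEquiv_injective ?_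
  rw [Measure.prodAssoc_prod, Measure.map_map MeasurableEquiv.prodAssoc.measurable
    ((hX.prodMk hY).prodMk hZ), ← (indepFun_iff_map_prod_eq_prod_map_map hY.aemeasurable
    hZ.aemeasurable).1 hYZ, ← (indepFun_iff_map_prod_eq_prod_map_map hX.aemeasurable
    (hY.prodMk hZ).aemeasurable).1 h]
  rfl

/-- Vitali's theorem for a sequence dominated by a uniformly integrable one. -/
lemma convergesAEAndL1_of_dominated {E : Type*} [NormedAddCommGroup E] {X : ℕ → Ω → E} {a : E}
    {Y : ℕ → Ω → ℝ} (hX : ∀ n, AEStronglyMeasurable (X n) μ) (hY : UnifIntegrable Y 1 μ)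
    (hY1 : ∀ n, MemLp (Y n) 1 μ) (hle : ∀ n, ∀ᵐ ω ∂μ, ‖X n ω‖ ≤ Y n ω)
    (hlim : ∀ᵐ ω ∂μ, Tendsto (fun n => X n ω) atTop (𝓝 a)) : ConvergesAEAndL1 μ X a := by
  refine ⟨hlim, fun n => (hY1 n).mono' (hX n) (hle n), ?_⟩
  refine tendsto_Lp_finite_of_tendsto_ae le_rfl ENNReal.one_ne_top hX (memLp_const a) ?_ hlim
  intro ε hε
  obtain ⟨δ, hδ, h⟩ := hY hε
  refine ⟨δ, hδ, fun n s hs hμs => le_trans (eLpNorm_mono_ae ?_) (h n s hs hμs)⟩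
  filter_upwards [hle n] with ω hω
  by_cases hωs : ω ∈ s
  · simpa [hωs] using hω.trans (le_abs_self _)
  · simp [hωs]

end Orthogonal

/-! ### Sample paths of the urn -/

section Paths

variable {K : ℕ}

lemma drawnColor_apply (c : Fin K → ℝ) (u : ℝ) (i : Fin K) :
    drawnColor c u i =
      (Set.Ioc (∑ j ∈ Finset.Iio i, c j / ∑ l, c l)
        (∑ j ∈ Finset.Iic i, c j / ∑ l, c l)).indicator (fun _ => (1 : ℝ)) u := by
  rw [drawnColor, Finset.sum_apply, Finset.sum_eq_single i]
  · by_cases h : u ∈ Set.Ioc (∑ j ∈ Finset.Iio i, c j / ∑ l, c l)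
        (∑ j ∈ Finset.Iic i, c j / ∑ l, c l)
    · simp [h]
    · simp [Set.indicator_of_notMem h]
  · intro j _ hj
    by_cases h : u ∈ Set.Ioc (∑ k ∈ Finset.Iio j, c k / ∑ l, c l)
        (∑ k ∈ Finset.Iic j, c k / ∑ l, c l)
    · simp [Set.indicator_of_mem h, Pi.single_eq_of_ne (Ne.symm hj)]
    · simp [Set.indicator_of_notMem h]
  · simp

lemma drawnColor_nonneg (c : Fin K → ℝ) (u : ℝ) (i : Fin K) : 0 ≤ drawnColor c u i := by
  rw [drawnColor_apply]
  exact Set.indicator_nonneg (fun _ _ => zero_le_one) u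

lemma drawnColor_le_one (c : Fin K → ℝ) (u : ℝ) (i : Fin K) : drawnColor c u i ≤ 1 := by
  rw [drawnColor_apply]
  exact Set.indicator_le_self' (fun _ _ => zero_le_one) u

lemma measurable_matrix_apply (i j : Fin K) :
    Measurable fun M : Matrix (Fin K) (Fin K) ℝ => M i j :=
  measurable_pi_iff.1 (measurable_pi_apply (X := fun _ : Fin K => Fin K → ℝ) i) j

lemma Measurable.drawnColor_apply {α : Type*} [MeasurableSpace α] {c : α → Fin K → ℝ} {u : α → ℝ}
    (hc : Measurable c) (hu : Measurable u) (i : Fin K) :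
    Measurable fun a => drawnColor (c a) (u a) i := by
  have hc' : ∀ s : Finset (Fin K), Measurable fun a => ∑ j ∈ s, c a j / ∑ l, c a l := fun s =>
    Finset.measurable_fun_sum _ fun j _ => (measurable_pi_iff.1 hc j).div
      (Finset.measurable_fun_sum _ fun l _ => measurable_pi_iff.1 hc l)
  simp only [_root_.drawnColor_apply, Set.indicator_apply]
  exact Measurable.ite ((measurableSet_lt (hc' _) hu).inter (measurableSet_le hu (hc' _)))
    measurable_const measurable_const

lemma Measurable.urnComposition {α : Type*} [MeasurableSpace α] {c : α → Fin K → ℝ}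
    {r : α → ℕ → Matrix (Fin K) (Fin K) ℝ} {u : α → ℕ → ℝ} (hc : Measurable c)
    (hr : Measurable r) (hu : Measurable u) (n : ℕ) :
    Measurable fun a => urnComposition (c a) (r a) (u a) n := by
  induction n with
  | zero => exact hc
  | succ n ih =>
    refine measurable_pi_iff.2 fun j => ?_
    simp only [_root_.urnComposition, Pi.add_apply, Matrix.vecMul, dotProduct]
    refine (measurable_pi_iff.1 ih j).add (Finset.measurable_fun_sum _ fun i _ => ?_)
    exact (Measurable.drawnColor_apply ih (measurable_pi_iff.1 hu n) i).mul
      ((measurable_matrix_apply i j).comp (measurable_pi_iff.1 hr n))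

variable (c₀ : Fin K → ℝ) (r : ℕ → Matrix (Fin K) (Fin K) ℝ) (u : ℕ → ℝ)

lemma urnComposition_congr {r r' : ℕ → Matrix (Fin K) (Fin K) ℝ} {u u' : ℕ → ℝ} {n : ℕ}
    (hr : ∀ k < n, r k = r' k) (hu : ∀ k < n, u k = u' k) :
    urnComposition c₀ r u n = urnComposition c₀ r' u' n := by
  induction n with
  | zero => rfl
  | succ n ih =>
    rw [urnComposition, urnComposition, ih (fun k hk => hr k (by omega))
      (fun k hk => hu k (by omega)), hr n (by omega), hu n (by omega)]

lemma urnComposition_eq_sum (n : ℕ) (j : Fin K) :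
    urnComposition c₀ r u n j = c₀ j + ∑ k ∈ Finset.range n, ∑ i,
      drawnColor (urnComposition c₀ r u k) (u k) i * r k i j := by
  induction n with
  | zero => simp [urnComposition]
  | succ n ih =>
    rw [Finset.sum_range_succ, ← add_assoc, ← ih]
    rfl

variable {c₀ r}

lemma le_urnComposition (hr : ∀ k i j, 0 ≤ r k i j) (n : ℕ) (j : Fin K) :
    c₀ j ≤ urnComposition c₀ r u n j := by
  rw [urnComposition_eq_sum]
  exact le_add_of_nonneg_right (Finset.sum_nonneg fun k _ => Finset.sum_nonneg fun i _ =>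
    mul_nonneg (drawnColor_nonneg _ _ _) (hr k i j))

lemma urnTotal_pos (h0 : ∀ i, 0 ≤ c₀ i) (hne : c₀ ≠ 0) (hr : ∀ k i j, 0 ≤ r k i j) (n : ℕ) :
    0 < urnTotal c₀ r u n := by
  obtain ⟨i, hi⟩ := Function.ne_iff.1 hne
  refine Finset.sum_pos' (fun j _ => (h0 j).trans (le_urnComposition u hr n j))
    ⟨i, Finset.mem_univ _, ?_⟩
  exact (lt_of_le_of_ne (h0 i) (Ne.symm hi)).trans_le (le_urnComposition u hr n i)

lemma urnTotal_le (hr : ∀ k i j, 0 ≤ r k i j) (n : ℕ) :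
    urnTotal c₀ r u n ≤ ∑ i, |c₀ i| + ∑ k ∈ Finset.range n, ∑ i, ∑ j, |r k i j| := by
  have h1 : urnTotal c₀ r u n = ∑ j, c₀ j + ∑ k ∈ Finset.range n, ∑ i, ∑ j,
      drawnColor (urnComposition c₀ r u k) (u k) i * r k i j := by
    simp only [urnTotal, urnComposition_eq_sum c₀ r u n, Finset.sum_add_distrib]
    congr 1
    rw [Finset.sum_comm]
    exact Finset.sum_congr rfl fun k _ => Finset.sum_comm
  rw [h1]
  refine add_le_add (Finset.sum_le_sum fun i _ => le_abs_self _) (Finset.sum_le_sum fun k _ =>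
    Finset.sum_le_sum fun i _ => Finset.sum_le_sum fun j _ => ?_)
  rw [abs_of_nonneg (hr k i j)]
  exact mul_le_of_le_one_left (hr k i j) (drawnColor_le_one _ _ _)

/-- A uniform variable draws each colour with probability equal to its proportion in the urn. -/
lemma integral_drawnColor {Ω : Type*} [MeasurableSpace Ω] {μ : Measure Ω} {V : Ω → ℝ}
    (hV : Measurable V) (hunif : pdf.IsUniform V (Set.Ioo 0 1) μ) {c : Fin K → ℝ}
    (hc : ∀ i, 0 ≤ c i) (hS : 0 < ∑ l, c l) (i : Fin K) :
    ∫ ω, drawnColor c (V ω) i ∂μ = c i / ∑ l, c l := by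
  set a := ∑ j ∈ Finset.Iio i, c j / ∑ l, c l with ha
  set b := ∑ j ∈ Finset.Iic i, c j / ∑ l, c l with hb
  have hq : ∀ j, 0 ≤ c j / ∑ l, c l := fun j => div_nonneg (hc j) hS.le
  have hab : b = a + c i / ∑ l, c l := by
    rw [hb, ha, ← Finset.Iio_insert, Finset.sum_insert (by simp), add_comm]
  have ha0 : 0 ≤ a := Finset.sum_nonneg fun j _ => hq j
  have hb1 : b ≤ 1 := by
    calc b ≤ ∑ j, c j / ∑ l, c l :=
          Finset.sum_le_sum_of_subset_of_nonneg (Finset.subset_univ _) fun j _ _ => hq j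
      _ = 1 := by rw [← Finset.sum_div, div_self hS.ne']
  have hpre : (fun ω => drawnColor c (V ω) i) =
      (V ⁻¹' Set.Ioc a b).indicator (fun _ => (1 : ℝ)) := by
    funext ω
    rw [drawnColor_apply]
    rfl
  have hvol : volume (Set.Ioo (0 : ℝ) 1 ∩ Set.Ioc a b) = ENNReal.ofReal (b - a) := by
    refine le_antisymm ?_ ?_
    · rw [← Real.volume_Ioc]
      exact measure_mono Set.inter_subset_right
    · rw [← Real.volume_Ioo]
      exact measure_mono fun x hx =>
        ⟨⟨ha0.trans_lt hx.1, hx.2.trans_le hb1⟩, ⟨hx.1, hx.2.le⟩⟩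
  rw [hpre, integral_indicator (hV measurableSet_Ioc), setIntegral_const, smul_eq_mul, mul_one,
    Measure.real, hunif.measure_preimage (by simp) (by simp) measurableSet_Ioc, hvol]
  simp only [Real.volume_Ioo, sub_zero, ENNReal.ofReal_one, div_one]
  rw [ENNReal.toReal_ofReal (by rw [hab]; linarith [hq i]), hab]
  ring

lemma abs_entry_le_linftyOpNorm (M : Matrix (Fin K) (Fin K) ℝ) (i j : Fin K) : |M i j| ≤ ‖M‖ := by
  have h1 : ∑ j, ‖M i j‖₊ ≤ ‖M‖₊ := by
    rw [Matrix.linfty_opNNNorm_def]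
    exact Finset.le_sup (f := fun i => ∑ j, ‖M i j‖₊) (Finset.mem_univ i)
  have h2 : ‖M i j‖₊ ≤ ‖M‖₊ :=
    (Finset.single_le_sum (f := fun j => ‖M i j‖₊) (fun _ _ => zero_le)
      (Finset.mem_univ j)).trans h1
  exact_mod_cast h2

end Paths

/-! ### Laws of large numbers along the urn -/

section LawOfLargeNumbers

/-- The truncation error of an integrable variable vanishes in mean. -/
lemma tendsto_integral_abs_sub_min {Ω : Type*} [MeasurableSpace Ω] {μ : Measure Ω}
    {f : Ω → ℝ} (hf : Integrable f μ) :
    Tendsto (fun B : ℕ => ∫ ω, (|f ω| - min |f ω| B) ∂μ) atTop (𝓝 0) := by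
  have h := tendsto_integral_of_dominated_convergence (μ := μ)
    (F := fun (B : ℕ) ω => |f ω| - min |f ω| B) (f := fun _ => 0) (fun ω => |f ω|)
    (fun B => (hf.abs.aestronglyMeasurable.aemeasurable.sub
      (hf.abs.aestronglyMeasurable.aemeasurable.min aemeasurable_const)).aestronglyMeasurable)
    hf.abs (fun B => Eventually.of_forall fun ω => ?_) (Eventually.of_forall fun ω => ?_)
  · simpa using h
  · rw [Real.norm_eq_abs, abs_of_nonneg (sub_nonneg.2 (min_le_left _ _))]
    have : 0 ≤ min |f ω| (B : ℝ) := le_min (abs_nonneg _) (Nat.cast_nonneg _)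
    linarith
  · refine tendsto_const_nhds.congr' ?_
    filter_upwards [eventually_ge_atTop ⌈|f ω|⌉₊] with B hB
    rw [min_eq_left (Nat.ceil_le.1 hB), sub_self]

variable {Ω : Type*} [MeasurableSpace Ω] {μ : Measure Ω} [IsProbabilityMeasure μ] {K : ℕ}
  {C₀ : Ω → Fin K → ℝ} {R : ℕ → Ω → Matrix (Fin K) (Fin K) ℝ} {U : ℕ → Ω → ℝ}

/-- The draw at time `n` is independent of the past, which consists of `C₀`, all the replacement
matrices, and the uniform variables before time `n`. -/
lemma indepFun_past_uniform (hC₀ : Measurable C₀) (hR : ∀ n, Measurable (R n))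
    (hU : ∀ n, Measurable (U n)) (hU_indep : iIndepFun U μ)
    (hRU : IndepFun (fun ω n => R n ω) (fun ω n => U n ω) μ)
    (hC₀RU : IndepFun C₀ (fun ω => ((fun n => R n ω), (fun n => U n ω))) μ) (n : ℕ) :
    IndepFun (fun ω => (C₀ ω, (fun k => R k ω), truncSeq n fun k => U k ω)) (U n) μ := by
  have hR' : Measurable fun ω k => R k ω := measurable_pi_iff.2 hR
  have hU' : Measurable fun ω k => U k ω := measurable_pi_iff.2 hU
  have hUt := (measurable_truncSeq n).comp hU'
  have h1 : IndepFun (fun ω k => R k ω) (fun ω => (truncSeq n fun k => U k ω, U n ω)) μ :=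
    hRU.comp measurable_id ((measurable_truncSeq n).prodMk (measurable_pi_apply n))
  have h2 := h1.prodMk_left_of_prodMk_right hR' hUt (hU n) (hU_indep.indepFun_truncSeq hU n)
  have h3 : IndepFun C₀ (fun ω => (((fun k => R k ω), truncSeq n fun k => U k ω), U n ω)) μ :=
    hC₀RU.comp measurable_id ((measurable_fst.prodMk ((measurable_truncSeq n).comp
      measurable_snd)).prodMk ((measurable_pi_apply n).comp measurable_snd))
  exact h3.prodMk_left_of_prodMk_right hC₀ (hR'.prodMk hUt) (hU n) h2

/-- The replacement matrix at time `n` is independent of `C₀`, of the earlier replacement matrices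
and of all the uniform variables, hence of the colour it is applied to. -/
lemma indepFun_past_replacement (hC₀ : Measurable C₀) (hR : ∀ n, Measurable (R n))
    (hU : ∀ n, Measurable (U n)) (hR_indep : iIndepFun R μ)
    (hRU : IndepFun (fun ω n => R n ω) (fun ω n => U n ω) μ)
    (hC₀RU : IndepFun C₀ (fun ω => ((fun n => R n ω), (fun n => U n ω))) μ) (n : ℕ) :
    IndepFun (fun ω => (C₀ ω, (truncSeq n fun k => R k ω), fun k => U k ω)) (R n) μ := by
  have hR' : Measurable fun ω k => R k ω := measurable_pi_iff.2 hR
  have hU' : Measurable fun ω k => U k ω := measurable_pi_iff.2 hU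
  have hRt := (measurable_truncSeq n).comp hR'
  have h1 : IndepFun (fun ω k => U k ω) (fun ω => (truncSeq n fun k => R k ω, R n ω)) μ :=
    hRU.symm.comp measurable_id ((measurable_truncSeq n).prodMk (measurable_pi_apply n))
  have h2 := h1.prodMk_left_of_prodMk_right hU' hRt (hR n) (hR_indep.indepFun_truncSeq hR n)
  have h2' : IndepFun (fun ω => ((truncSeq n fun k => R k ω), fun k => U k ω)) (R n) μ :=
    h2.comp measurable_swap measurable_id
  have h3 : IndepFun C₀ (fun ω => (((truncSeq n fun k => R k ω), fun k => U k ω), R n ω)) μ :=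
    hC₀RU.comp measurable_id ((((measurable_truncSeq n).comp measurable_fst).prodMk
      measurable_snd).prodMk ((measurable_pi_apply n).comp measurable_fst))
  exact h3.prodMk_left_of_prodMk_right hC₀ (hRt.prodMk hU') (hR n) h2'

/-- The draws follow the proportions on average. -/
lemma tendsto_average_draw_sub_proportion (hC₀ : Measurable C₀)
    (hC₀_ne : ∀ᵐ ω ∂μ, C₀ ω ≠ 0) (hC₀_nonneg : ∀ᵐ ω ∂μ, ∀ i, 0 ≤ C₀ ω i)
    (hR : ∀ n, Measurable (R n)) (hR_nonneg : ∀ n, ∀ᵐ ω ∂μ, ∀ i j, 0 ≤ R n ω i j)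
    (hU : ∀ n, Measurable (U n)) (hU_unif : ∀ n, pdf.IsUniform (U n) (Set.Ioo 0 1) μ)
    (hU_indep : iIndepFun U μ) (hRU : IndepFun (fun ω n => R n ω) (fun ω n => U n ω) μ)
    (hC₀RU : IndepFun C₀ (fun ω => ((fun n => R n ω), (fun n => U n ω))) μ) (i : Fin K) :
    ∀ᵐ ω ∂μ, Tendsto (fun n : ℕ => (∑ k ∈ Finset.range n,
      (drawnColor (urnComposition (C₀ ω) (R · ω) (U · ω) k) (U k ω) i -
        urnComposition (C₀ ω) (R · ω) (U · ω) k i / urnTotal (C₀ ω) (R · ω) (U · ω) k)) / n)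
      atTop (𝓝 0) := by
  have hR' : Measurable fun ω k => R k ω := measurable_pi_iff.2 hR
  have hU' : Measurable fun ω k => U k ω := measurable_pi_iff.2 hU
  have hmain := tendsto_average_centred_of_indepFun (μ := μ)
    (Z := fun n ω => (C₀ ω, (fun k => R k ω), truncSeq n fun k => U k ω)) (V := U)
    (H := fun k q => drawnColor (urnComposition q.1.1 q.1.2.1 q.1.2.2 k) q.2 i) (B := 1)
    (fun n => hC₀.prodMk (hR'.prodMk ((measurable_truncSeq n).comp hU'))) hU
    (indepFun_past_uniform hC₀ hR hU hU_indep hRU hC₀RU) ?_ ?_ ?_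
  · filter_upwards [hmain, hC₀_ne, hC₀_nonneg, ae_all_iff.2 hR_nonneg] with ω hω hne hnn hRnn
    refine hω.congr fun n => ?_
    congr 1
    refine Finset.sum_congr rfl fun k _ => ?_
    have hC : urnComposition (C₀ ω) (fun k => R k ω) (truncSeq k fun k => U k ω) k =
        urnComposition (C₀ ω) (R · ω) (U · ω) k :=
      urnComposition_congr _ (fun _ _ => rfl) fun j hj => truncSeq_apply hj _
    simp only [hC]
    rw [integral_drawnColor (hU k) (hU_unif k)
      (fun j => (hnn j).trans (le_urnComposition _ hRnn k j)) (urnTotal_pos _ hnn hne hRnn k)]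
    rfl
  · intro k l hkl
    refine ⟨fun z => ((z.1, z.2.1, truncSeq k z.2.2), z.2.2 k), ?_, fun ω => ?_⟩
    · exact (measurable_fst.prodMk ((measurable_fst.comp measurable_snd).prodMk
        ((measurable_truncSeq k).comp (measurable_snd.comp measurable_snd)))).prodMk
        (measurable_pi_iff.1 measurable_snd.snd k)
    · simp only [truncSeq_truncSeq hkl.le, truncSeq_apply hkl]
  · exact fun n => Measurable.drawnColor_apply (Measurable.urnComposition
      measurable_fst.fst measurable_fst.snd.fst measurable_fst.snd.snd n) measurable_snd i
  · intro n q
    rw [abs_of_nonneg (drawnColor_nonneg _ _ _)]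
    exact drawnColor_le_one _ _ _

/-- The replacement entries truncated at level `B` average to their mean along the draws. -/
lemma tendsto_average_draw_mul_truncated (hC₀ : Measurable C₀) (hR : ∀ n, Measurable (R n))
    (hU : ∀ n, Measurable (U n)) (hR_indep : iIndepFun R μ)
    (hR_ident : ∀ n, IdentDistrib (R n) (R 0) μ μ)
    (hRU : IndepFun (fun ω n => R n ω) (fun ω n => U n ω) μ)
    (hC₀RU : IndepFun C₀ (fun ω => ((fun n => R n ω), (fun n => U n ω))) μ) (i j : Fin K) (B : ℕ) :
    ∀ᵐ ω ∂μ, Tendsto (fun n : ℕ => (∑ k ∈ Finset.range n,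
      drawnColor (urnComposition (C₀ ω) (R · ω) (U · ω) k) (U k ω) i *
        (min |R k ω i j| B - ∫ ω', min |R 0 ω' i j| B ∂μ)) / n) atTop (𝓝 0) := by
  have hR' : Measurable fun ω k => R k ω := measurable_pi_iff.2 hR
  have hU' : Measurable fun ω k => U k ω := measurable_pi_iff.2 hU
  have hF : Measurable fun M : Matrix (Fin K) (Fin K) ℝ => min |M i j| (B : ℝ) :=
    (measurable_matrix_apply i j).abs.min measurable_const
  have hdraw : ∀ n, Measurable fun q : (Fin K → ℝ) × (ℕ → Matrix (Fin K) (Fin K) ℝ) × (ℕ → ℝ) =>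
      drawnColor (urnComposition q.1 q.2.1 q.2.2 n) (q.2.2 n) i := fun n =>
    Measurable.drawnColor_apply (Measurable.urnComposition measurable_fst measurable_snd.fst
      measurable_snd.snd n) (measurable_pi_iff.1 measurable_snd.snd n) i
  have hmain := tendsto_average_centred_of_indepFun (μ := μ)
    (Z := fun n ω => (C₀ ω, (truncSeq n fun k => R k ω), fun k => U k ω)) (V := R)
    (H := fun k q => drawnColor (urnComposition q.1.1 q.1.2.1 q.1.2.2 k) (q.1.2.2 k) i *
      min |q.2 i j| (B : ℝ)) (B := B)
    (fun n => hC₀.prodMk (((measurable_truncSeq n).comp hR').prodMk hU')) hR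
    (indepFun_past_replacement hC₀ hR hU hR_indep hRU hC₀RU) ?_ ?_ ?_
  · filter_upwards [hmain] with ω hω
    refine hω.congr fun n => ?_
    congr 1
    refine Finset.sum_congr rfl fun k _ => ?_
    have hC : urnComposition (C₀ ω) (truncSeq k fun k => R k ω) (fun k => U k ω) k =
        urnComposition (C₀ ω) (R · ω) (U · ω) k :=
      urnComposition_congr _ (fun j hj => truncSeq_apply hj _) fun _ _ => rfl
    have hm : ∫ ω', min |R k ω' i j| (B : ℝ) ∂μ = ∫ ω', min |R 0 ω' i j| (B : ℝ) ∂μ :=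
      ((hR_ident k).comp hF).integral_eq
    simp only [hC]
    rw [integral_const_mul, hm, mul_sub]
  · intro k l hkl
    refine ⟨fun z => ((z.1, truncSeq k z.2.1, z.2.2), z.2.1 k), ?_, fun ω => ?_⟩
    · exact (measurable_fst.prodMk (((measurable_truncSeq k).comp (measurable_fst.comp
        measurable_snd)).prodMk (measurable_snd.comp measurable_snd))).prodMk
        (measurable_pi_iff.1 measurable_snd.fst k)
    · simp only [truncSeq_truncSeq hkl.le, truncSeq_apply hkl]
  · exact fun n => ((hdraw n).comp measurable_fst).mul (hF.comp measurable_snd)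
  · intro n q
    have h0 : 0 ≤ min |q.2 i j| (B : ℝ) := le_min (abs_nonneg _) (Nat.cast_nonneg _)
    rw [abs_of_nonneg (mul_nonneg (drawnColor_nonneg _ _ _) h0)]
    exact (mul_le_of_le_one_left h0 (drawnColor_le_one _ _ _)).trans (min_le_right _ _)

/-- The replacement entries average to their mean along the draws. The part above a truncation
level is dominated by an i.i.d. average of small mean, so a first moment is enough. -/
lemma tendsto_average_draw_mul_replacement (hC₀ : Measurable C₀) (hR : ∀ n, Measurable (R n))
    (hR_nonneg : ∀ n, ∀ᵐ ω ∂μ, ∀ i j, 0 ≤ R n ω i j)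
    (hU : ∀ n, Measurable (U n)) (hR_indep : iIndepFun R μ)
    (hR_ident : ∀ n, IdentDistrib (R n) (R 0) μ μ)
    (hRU : IndepFun (fun ω n => R n ω) (fun ω n => U n ω) μ)
    (hC₀RU : IndepFun C₀ (fun ω => ((fun n => R n ω), (fun n => U n ω))) μ) (i j : Fin K)
    (hint : Integrable (fun ω => R 0 ω i j) μ) :
    ∀ᵐ ω ∂μ, Tendsto (fun n : ℕ => (∑ k ∈ Finset.range n,
      drawnColor (urnComposition (C₀ ω) (R · ω) (U · ω) k) (U k ω) i *
        (R k ω i j - meanMatrix μ (R 0) i j)) / n) atTop (𝓝 0) := by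
  set m : ℕ → ℝ := fun B => ∫ ω', min |R 0 ω' i j| (B : ℝ) ∂μ with hm
  set τ : ℕ → ℝ := fun B => ∫ ω, (|R 0 ω i j| - min |R 0 ω i j| (B : ℝ)) ∂μ with hτ
  have hτlim : Tendsto τ atTop (𝓝 0) := tendsto_integral_abs_sub_min hint
  have hτ0 : ∀ B, 0 ≤ τ B := fun B => integral_nonneg fun ω => sub_nonneg.2 (min_le_left _ _)
  have hminint : ∀ B : ℕ, Integrable (fun ω => min |R 0 ω i j| (B : ℝ)) μ := fun B =>
    hint.abs.inf (integrable_const _)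
  have hmean : ∀ B, meanMatrix μ (R 0) i j = m B + τ B := by
    intro B
    rw [hm, hτ]
    simp only
    rw [integral_sub hint.abs (hminint B), add_sub_cancel]
    refine integral_congr_ae ?_
    filter_upwards [hR_nonneg 0] with ω hω
    rw [abs_of_nonneg (hω i j)]
  have hslln : ∀ B : ℕ, ∀ᵐ ω ∂μ, Tendsto (fun n : ℕ => (∑ k ∈ Finset.range n,
      (|R k ω i j| - min |R k ω i j| (B : ℝ))) / n) atTop (𝓝 (τ B)) := by
    intro B
    have hF : Measurable fun M : Matrix (Fin K) (Fin K) ℝ => |M i j| - min |M i j| (B : ℝ) :=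
      (measurable_matrix_apply i j).abs.sub
        ((measurable_matrix_apply i j).abs.min measurable_const)
    exact strong_law_ae_real (fun k ω => |R k ω i j| - min |R k ω i j| (B : ℝ))
      (hint.abs.sub (hminint B))
      (fun k l hkl => (hR_indep.indepFun hkl).comp hF hF) (fun k => (hR_ident k).comp hF)
  have htr : ∀ B : ℕ, _ := fun B =>
    tendsto_average_draw_mul_truncated hC₀ hR hU hR_indep hR_ident hRU hC₀RU i j B
  filter_upwards [ae_all_iff.2 hslln, ae_all_iff.2 htr, ae_all_iff.2 hR_nonneg] with ω h1 h2 hnn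
  set χ : ℕ → ℝ := fun k => drawnColor (urnComposition (C₀ ω) (R · ω) (U · ω) k) (U k ω) i with hχ
  have hχ0 : ∀ k, 0 ≤ χ k := fun k => drawnColor_nonneg _ _ _
  have hχ1 : ∀ k, χ k ≤ 1 := fun k => drawnColor_le_one _ _ _
  have hbound : ∀ (B n : ℕ), |(∑ k ∈ Finset.range n, χ k * (R k ω i j -
      meanMatrix μ (R 0) i j)) / n| ≤
      |(∑ k ∈ Finset.range n, χ k * (min |R k ω i j| (B : ℝ) - m B)) / n| +
        (∑ k ∈ Finset.range n, (|R k ω i j| - min |R k ω i j| (B : ℝ))) / n + τ B := by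
    intro B n
    rcases Nat.eq_zero_or_pos n with rfl | hn
    · simpa using hτ0 B
    have hnR : (0 : ℝ) < n := by exact_mod_cast hn
    have hsplit : ∑ k ∈ Finset.range n, χ k * (R k ω i j - meanMatrix μ (R 0) i j) =
        ∑ k ∈ Finset.range n, χ k * (min |R k ω i j| (B : ℝ) - m B) +
          ∑ k ∈ Finset.range n, χ k * (|R k ω i j| - min |R k ω i j| (B : ℝ)) -
          ∑ k ∈ Finset.range n, χ k * τ B := by
      rw [← Finset.sum_add_distrib, ← Finset.sum_sub_distrib]
      refine Finset.sum_congr rfl fun k _ => ?_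
      rw [hmean B, abs_of_nonneg (hnn k i j)]
      ring
    have hx : ∀ k, 0 ≤ |R k ω i j| - min |R k ω i j| (B : ℝ) := fun k =>
      sub_nonneg.2 (min_le_left _ _)
    have hb1 : |∑ k ∈ Finset.range n, χ k * (|R k ω i j| - min |R k ω i j| (B : ℝ))| ≤
        ∑ k ∈ Finset.range n, (|R k ω i j| - min |R k ω i j| (B : ℝ)) := by
      rw [abs_of_nonneg (Finset.sum_nonneg fun k _ => mul_nonneg (hχ0 k) (hx k))]
      exact Finset.sum_le_sum fun k _ => mul_le_of_le_one_left (hx k) (hχ1 k)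
    have hb2 : |∑ k ∈ Finset.range n, χ k * τ B| ≤ n * τ B := by
      rw [abs_of_nonneg (Finset.sum_nonneg fun k _ => mul_nonneg (hχ0 k) (hτ0 B))]
      calc _ ≤ ∑ k ∈ Finset.range n, τ B :=
            Finset.sum_le_sum fun k _ => mul_le_of_le_one_left (hτ0 B) (hχ1 k)
        _ = n * τ B := by simp
    rw [hsplit, abs_div, abs_div, Nat.abs_cast, ← add_div, div_add' _ _ _ hnR.ne']
    refine div_le_div_of_nonneg_right ?_ hnR.le
    refine (abs_sub _ _).trans ?_
    refine add_le_add ((abs_add_le _ _).trans (add_le_add le_rfl hb1)) ?_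
    rw [mul_comm (τ B)]
    exact hb2
  rw [tendsto_zero_iff_abs_tendsto_zero, tendsto_order]
  refine ⟨fun a ha => Eventually.of_forall fun n => ha.trans_le (abs_nonneg _), fun ε hε => ?_⟩
  obtain ⟨B, hB⟩ := (hτlim.eventually_lt_const (show 0 < ε / 2 by positivity)).exists
  have hlim := (((h2 B).abs).add (h1 B)).add_const (τ B)
  rw [abs_zero, zero_add] at hlim
  filter_upwards [hlim.eventually_lt_const (show τ B + τ B < ε by linarith)] with n hn
  exact (hbound B n).trans_lt hn

end LawOfLargeNumbers

/-! ### Convergence of the urn -/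

section Convergence

variable {K : ℕ}

/-- The four limits hold along every sample path on which the draws follow the proportions on
average and the replacement entries average to `A` along the draws. -/
theorem tendsto_urn_of_tendsto_averages [NeZero K] {A : Matrix (Fin K) (Fin K) ℝ}
    (hA : A.IsIrreducible) {lam : ℝ} {p h : Fin K → ℝ} (hlam : 0 < lam) (hp : ∀ i, 0 < p i)
    (hp1 : ∑ i, p i = 1) (hh : ∀ i, 0 < h i) (hpA : p ᵥ* A = lam • p) (hhA : A *ᵥ h = lam • h)
    {c₀ : Fin K → ℝ} {r : ℕ → Matrix (Fin K) (Fin K) ℝ} {u : ℕ → ℝ}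
    (h0 : ∀ i, 0 ≤ c₀ i) (hne : c₀ ≠ 0) (hr : ∀ k i j, 0 ≤ r k i j)
    (hdraw : ∀ i, Tendsto (fun n : ℕ => (∑ k ∈ Finset.range n,
      (drawnColor (urnComposition c₀ r u k) (u k) i -
        urnComposition c₀ r u k i / urnTotal c₀ r u k)) / n) atTop (𝓝 0))
    (hrep : ∀ i j, Tendsto (fun n : ℕ => (∑ k ∈ Finset.range n,
      drawnColor (urnComposition c₀ r u k) (u k) i * (r k i j - A i j)) / n) atTop (𝓝 0)) :
    Tendsto (fun n => (urnTotal c₀ r u n)⁻¹ • urnComposition c₀ r u n) atTop (𝓝 p) ∧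
    Tendsto (fun n : ℕ => urnTotal c₀ r u n / n) atTop (𝓝 lam) ∧
    Tendsto (fun n : ℕ => (n : ℝ)⁻¹ • urnComposition c₀ r u n) atTop (𝓝 (lam • p)) ∧
    Tendsto (fun n : ℕ => (n : ℝ)⁻¹ • urnCount c₀ r u n) atTop (𝓝 p) := by
  set C := urnComposition c₀ r u with hCdef
  set S := urnTotal c₀ r u with hSdef
  set χ : ℕ → Fin K → ℝ := fun k => drawnColor (C k) (u k) with hχ
  set z : ℕ → Fin K → ℝ := fun n => (n : ℝ)⁻¹ • ∑ k ∈ Finset.range n, (∑ i, C k i)⁻¹ • C k with hz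
  have hzi : ∀ n i, z n i = (n : ℝ)⁻¹ * ∑ k ∈ Finset.range n, C k i / S k := by
    intro n i
    simp only [hz, Pi.smul_apply, Finset.sum_apply, smul_eq_mul]
    congr 1
    exact Finset.sum_congr rfl fun k _ => inv_mul_eq_div _ _
  have hSpos : ∀ n, 0 < S n := urnTotal_pos u h0 hne hr
  have hlim : Tendsto (fun n : ℕ => (n : ℝ)⁻¹ • C n - z n ᵥ* A) atTop (𝓝 0) := by
    refine tendsto_pi_nhds.2 fun j => ?_
    have h1 : Tendsto (fun n : ℕ => (n : ℝ)⁻¹ * c₀ j +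
        ∑ i, ((∑ k ∈ Finset.range n, χ k i * (r k i j - A i j)) / n +
          (∑ k ∈ Finset.range n, (χ k i - C k i / S k)) / n * A i j)) atTop (𝓝 0) := by
      have := (tendsto_inv_atTop_nhds_zero_nat (𝕜 := ℝ)).mul_const (c₀ j)
      have h2 := tendsto_finsetSum (Finset.univ : Finset (Fin K)) fun i _ =>
        (hrep i j).add ((hdraw i).mul_const (A i j))
      simpa using this.add h2
    refine h1.congr fun n => ?_
    have hterm : ∀ i, (∑ k ∈ Finset.range n, χ k i * (r k i j - A i j)) / n +
          (∑ k ∈ Finset.range n, (χ k i - C k i / S k)) / n * A i j =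
        (n : ℝ)⁻¹ * ∑ k ∈ Finset.range n, χ k i * r k i j - z n i * A i j := by
      intro i
      rw [hzi]
      simp only [mul_sub, Finset.sum_sub_distrib, ← Finset.sum_mul]
      ring
    have hCn : C n j = c₀ j + ∑ i, ∑ k ∈ Finset.range n, χ k i * r k i j := by
      rw [Finset.sum_comm]
      exact urnComposition_eq_sum c₀ r u n j
    have hzA : (z n ᵥ* A) j = ∑ i, z n i * A i j := rfl
    rw [Finset.sum_congr rfl fun i _ => hterm i, Finset.sum_sub_distrib, ← Finset.mul_sum,
      Pi.sub_apply, Pi.smul_apply, smul_eq_mul, hCn, hzA]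
    ring
  have hzlim : Tendsto z atTop (𝓝 p) :=
    hA.tendsto_average_proportions hlam hp hp1 hh hpA hhA
      (fun n i => (h0 i).trans (le_urnComposition u hr n i)) hSpos hlim
  have hClim : Tendsto (fun n : ℕ => (n : ℝ)⁻¹ • C n) atTop (𝓝 (lam • p)) := by
    have hcont : Continuous fun v : Fin K → ℝ => v ᵥ* A :=
      continuous_id.matrix_vecMul continuous_const
    have := hlim.add ((hcont.tendsto p).comp hzlim)
    rw [zero_add, hpA] at this
    exact this.congr fun n => by simp
  have hSlim : Tendsto (fun n : ℕ => S n / n) atTop (𝓝 lam) := by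
    have h1 := tendsto_finsetSum (Finset.univ : Finset (Fin K)) fun i _ =>
      (tendsto_pi_nhds.1 hClim) i
    simp only [Pi.smul_apply, smul_eq_mul, ← Finset.mul_sum, hp1, mul_one] at h1
    exact h1.congr fun n => inv_mul_eq_div _ _
  refine ⟨?_, hSlim, hClim, ?_⟩
  · have h1 := (hSlim.inv₀ hlam.ne').smul hClim
    rw [smul_smul, inv_mul_cancel₀ hlam.ne', one_smul] at h1
    refine h1.congr' ?_
    filter_upwards [eventually_gt_atTop 0] with n hn
    have hnR : (n : ℝ) ≠ 0 := by exact_mod_cast hn.ne'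
    rw [smul_smul]
    congr 1
    field_simp
  · refine tendsto_pi_nhds.2 fun i => ?_
    have h1 := (hdraw i).add ((tendsto_pi_nhds.1 hzlim) i)
    rw [zero_add] at h1
    refine h1.congr fun n => ?_
    rw [hzi, Finset.sum_sub_distrib, Pi.smul_apply, smul_eq_mul, urnCount, Finset.sum_apply]
    simp only [hCdef]
    ring

lemma norm_inv_smul_urnCount_le (c₀ : Fin K → ℝ) (r : ℕ → Matrix (Fin K) (Fin K) ℝ) (u : ℕ → ℝ)
    (n : ℕ) : ‖(n : ℝ)⁻¹ • urnCount c₀ r u n‖ ≤ 1 := by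
  refine (pi_norm_le_iff_of_nonneg zero_le_one).2 fun i => ?_
  have h0 : 0 ≤ urnCount c₀ r u n i := by
    rw [urnCount, Finset.sum_apply]
    exact Finset.sum_nonneg fun k _ => drawnColor_nonneg _ _ _
  have h1 : urnCount c₀ r u n i ≤ n := by
    rw [urnCount, Finset.sum_apply]
    calc _ ≤ ∑ k ∈ Finset.range n, (1 : ℝ) :=
          Finset.sum_le_sum fun k _ => drawnColor_le_one _ _ _
      _ = n := by simp
  rw [Pi.smul_apply, smul_eq_mul, Real.norm_of_nonneg (mul_nonneg (by positivity) h0),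
    inv_mul_eq_div]
  exact div_le_one_of_le₀ h1 (Nat.cast_nonneg n)

lemma norm_inv_smul_urnComposition_le {c₀ : Fin K → ℝ} {r : ℕ → Matrix (Fin K) (Fin K) ℝ}
    (u : ℕ → ℝ) (h0 : ∀ i, 0 ≤ c₀ i) (hr : ∀ k i j, 0 ≤ r k i j) {s : ℝ} (hs : 0 ≤ s) (n : ℕ) :
    ‖s⁻¹ • urnComposition c₀ r u n‖ ≤ urnTotal c₀ r u n / s := by
  have hC : ∀ i, 0 ≤ urnComposition c₀ r u n i := fun i => (h0 i).trans (le_urnComposition u hr n i)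
  have hle : ∀ i, urnComposition c₀ r u n i ≤ urnTotal c₀ r u n := fun i =>
    Finset.single_le_sum (fun j _ => hC j) (Finset.mem_univ i)
  refine (pi_norm_le_iff_of_nonneg (div_nonneg (Finset.sum_nonneg fun i _ => hC i) hs)).2
    fun i => ?_
  rw [Pi.smul_apply, smul_eq_mul, Real.norm_of_nonneg (mul_nonneg (inv_nonneg.2 hs) (hC i)),
    inv_mul_eq_div]
  exact div_le_div_of_nonneg_right (hle i) hs

end Convergence

theorem mainTheorem2 {Ω : Type*} [MeasurableSpace Ω] (μ : Measure Ω) [IsProbabilityMeasure μ]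
    (K : ℕ)
    (C₀ : Ω → Fin K → ℝ) (R : ℕ → Ω → Matrix (Fin K) (Fin K) ℝ) (U : ℕ → Ω → ℝ)
    -- the initial configuration: nonzero, nonnegative entries, finite mean
    (hC₀_meas : Measurable C₀)
    (hC₀_ne : ∀ᵐ ω ∂μ, C₀ ω ≠ 0)
    (hC₀_nonneg : ∀ᵐ ω ∂μ, ∀ i, 0 ≤ C₀ ω i)
    (hC₀_int : ∀ i, Integrable (fun ω => C₀ ω i) μ)
    -- the replacement matrices: nonnegative entries, i.i.d., integrable norm, irreducible mean
    (hR_meas : ∀ n, Measurable (R n))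
    (hR_nonneg : ∀ n, ∀ᵐ ω ∂μ, ∀ i j, 0 ≤ R n ω i j)
    (hR_indep : iIndepFun R μ)
    (hR_ident : ∀ n, IdentDistrib (R n) (R 0) μ μ)
    (hR_int : Integrable (fun ω => ‖R 0 ω‖) μ)
    (hH : (meanMatrix μ (R 0)).IsIrreducible)
    -- the i.i.d. uniform variables
    (hU_meas : ∀ n, Measurable (U n))
    (hU_unif : ∀ n, pdf.IsUniform (U n) (Set.Ioo 0 1) μ)
    (hU_indep : iIndepFun U μ)
    -- the initial configuration, the matrices and the uniform variables are independent
    (hRU : IndepFun (fun ω n => R n ω) (fun ω n => U n ω) μ)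
    (hC₀RU : IndepFun C₀ (fun ω => ((fun n => R n ω), (fun n => U n ω))) μ) :
    ∃ (lam : ℝ) (p : Fin K → ℝ),
      IsDominantEigenvalue (meanMatrix μ (R 0)) lam ∧
      IsPerronVector (meanMatrix μ (R 0)) lam p ∧
      (∀ q, IsPerronVector (meanMatrix μ (R 0)) lam q → q = p) ∧
      ConvergesAEAndL1 μ
        (fun n ω => (urnTotal (C₀ ω) (R · ω) (U · ω) n)⁻¹ •
          urnComposition (C₀ ω) (R · ω) (U · ω) n) p ∧
      ConvergesAEAndL1 μ
        (fun n ω => urnTotal (C₀ ω) (R · ω) (U · ω) n / n) lam ∧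
      ConvergesAEAndL1 μ
        (fun n ω => (n : ℝ)⁻¹ • urnComposition (C₀ ω) (R · ω) (U · ω) n) (lam • p) ∧
      ConvergesAEAndL1 μ
        (fun n ω => (n : ℝ)⁻¹ • urnCount (C₀ ω) (R · ω) (U · ω) n) p := by
  -- without colours the only configuration is zero, which `hC₀_ne` excludes
  rcases Nat.eq_zero_or_pos K with rfl | hK
  · obtain ⟨ω, hω⟩ := hC₀_ne.exists
    exact absurd (Subsingleton.elim _ _) hω
  have : NeZero K := ⟨hK.ne'⟩
  obtain ⟨lam, p, h, hlam, hp, hp1, hpA, hh, hhA⟩ := hH.exists_perron_pair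
  have hR' : Measurable fun ω k => R k ω := measurable_pi_iff.2 hR_meas
  have hU' : Measurable fun ω k => U k ω := measurable_pi_iff.2 hU_meas
  have hint : ∀ i j, Integrable (fun ω => R 0 ω i j) μ := fun i j =>
    hR_int.mono' ((measurable_matrix_apply i j).comp (hR_meas 0)).aestronglyMeasurable
      (Eventually.of_forall fun ω => abs_entry_le_linftyOpNorm _ i j)
  have hlimits := (ae_all_iff.2 fun i => tendsto_average_draw_sub_proportion hC₀_meas hC₀_ne
    hC₀_nonneg hR_meas hR_nonneg hU_meas hU_unif hU_indep hRU hC₀RU i).and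
    (ae_all_iff.2 fun i => ae_all_iff.2 fun j => tendsto_average_draw_mul_replacement hC₀_meas
      hR_meas hR_nonneg hU_meas hR_indep hR_ident hRU hC₀RU i j (hint i j))
  have hpath := (hlimits.and (hC₀_ne.and (hC₀_nonneg.and (ae_all_iff.2 hR_nonneg)))).mono
    fun ω hω => tendsto_urn_of_tendsto_averages hH hlam hp hp1 hh hpA hhA hω.2.2.1 hω.2.1
      hω.2.2.2 hω.1.1 hω.1.2
  have hCm : ∀ n, Measurable fun ω => urnComposition (C₀ ω) (R · ω) (U · ω) n :=
    Measurable.urnComposition hC₀_meas hR' hU'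
  have hSm : ∀ n, Measurable fun ω => urnTotal (C₀ ω) (R · ω) (U · ω) n := fun n =>
    Finset.measurable_fun_sum _ fun i _ => measurable_pi_iff.1 (hCm n) i
  have hNm : ∀ n, Measurable fun ω => urnCount (C₀ ω) (R · ω) (U · ω) n := fun n =>
    Finset.measurable_fun_sum _ fun k _ => measurable_pi_iff.2 fun i =>
      Measurable.drawnColor_apply (hCm k) (hU_meas k) i
  -- the contents are dominated by the initial content plus an average of i.i.d. variables
  set W : ℕ → Ω → ℝ := fun k ω => ∑ i, ∑ j, |R k ω i j| with hW
  set Y₀ : Ω → ℝ := fun ω => ∑ i, |C₀ ω i| with hY₀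
  have hWm : Measurable fun M : Matrix (Fin K) (Fin K) ℝ => ∑ i, ∑ j, |M i j| :=
    Finset.measurable_fun_sum _ fun i _ => Finset.measurable_fun_sum _ fun j _ =>
      (measurable_matrix_apply i j).abs
  have hW1 : MemLp (W 0) 1 μ := memLp_one_iff_integrable.2 <|
    integrable_finsetSum _ fun i _ => integrable_finsetSum _ fun j _ => (hint i j).abs
  have hY₀1 : MemLp Y₀ 1 μ := memLp_one_iff_integrable.2 <|
    integrable_finsetSum _ fun i _ => (hC₀_int i).abs
  have hWui : UniformIntegrable W 1 μ :=
    MemLp.uniformIntegrable_of_identDistrib le_rfl ENNReal.one_ne_top hW1 fun k =>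
      (hR_ident k).comp hWm
  have hAvg := uniformIntegrable_average_real le_rfl hWui
  set Y : ℕ → Ω → ℝ :=
    (fun _ => Y₀) + fun n => (∑ k ∈ Finset.range n, W k) / (n : Ω → ℝ) with hY
  have hYui : UnifIntegrable Y 1 μ :=
    (unifIntegrable_const le_rfl ENNReal.one_ne_top hY₀1).add hAvg.unifIntegrable le_rfl
      (fun _ => hY₀1.1) hAvg.1
  have hYLp : ∀ n, MemLp (Y n) 1 μ := fun n => hY₀1.add (hAvg.memLp n)
  have hSle : ∀ n : ℕ, ∀ᵐ ω ∂μ, urnTotal (C₀ ω) (R · ω) (U · ω) n / n ≤ Y n ω := by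
    intro n
    filter_upwards [ae_all_iff.2 hR_nonneg] with ω hRnn
    have hY0 : 0 ≤ Y₀ ω := Finset.sum_nonneg fun i _ => abs_nonneg _
    simp only [hY, Pi.add_apply, Pi.div_apply, Finset.sum_apply, Pi.natCast_apply]
    rcases Nat.eq_zero_or_pos n with rfl | hn
    · simpa using hY0
    have hnR : (1 : ℝ) ≤ n := by exact_mod_cast hn
    calc _ ≤ (Y₀ ω + ∑ k ∈ Finset.range n, W k ω) / n :=
          div_le_div_of_nonneg_right (urnTotal_le _ hRnn n) (by positivity)
      _ ≤ _ := by
          rw [add_div]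
          exact add_le_add (div_le_self hY0 hnR) le_rfl
  have hone : UnifIntegrable (fun (_ : ℕ) (_ : Ω) => (1 : ℝ)) 1 μ :=
    unifIntegrable_const le_rfl ENNReal.one_ne_top (memLp_const 1)
  refine ⟨lam, p, isDominantEigenvalue_of_pos hH.nonneg hh hhA, ⟨hp, hp1, hpA⟩, ?_, ?_, ?_, ?_, ?_⟩
  · rintro q ⟨-, hq1, hqA⟩
    obtain ⟨m, rfl⟩ := hH.eq_smul_perron hp hpA hqA
    simp only [Pi.smul_apply, smul_eq_mul, ← Finset.mul_sum, hp1, mul_one] at hq1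
    rw [hq1, one_smul]
  · refine convergesAEAndL1_of_dominated
      (fun n => ((hSm n).inv.smul (hCm n)).aestronglyMeasurable) hone
      (fun _ => memLp_const 1) (fun n => ?_) (hpath.mono fun ω hω => hω.1)
    filter_upwards [hC₀_ne, hC₀_nonneg, ae_all_iff.2 hR_nonneg] with ω hne hnn hRnn
    have hS := urnTotal_pos (fun k => U k ω) hnn hne hRnn n
    exact (norm_inv_smul_urnComposition_le _ hnn hRnn hS.le n).trans (div_self hS.ne').le
  · refine convergesAEAndL1_of_dominated (fun n => ((hSm n).div_const _).aestronglyMeasurable)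
      hYui hYLp (fun n => ?_) (hpath.mono fun ω hω => hω.2.1)
    filter_upwards [hSle n, hC₀_ne, hC₀_nonneg, ae_all_iff.2 hR_nonneg] with ω hle hne hnn hRnn
    rwa [Real.norm_of_nonneg
      (div_nonneg (urnTotal_pos (fun k => U k ω) hnn hne hRnn n).le (Nat.cast_nonneg n))]
  · refine convergesAEAndL1_of_dominated
      (fun n => ((hCm n).const_smul ((n : ℝ)⁻¹)).aestronglyMeasurable)
      hYui hYLp (fun n => ?_) (hpath.mono fun ω hω => hω.2.2.1)
    filter_upwards [hSle n, hC₀_nonneg, ae_all_iff.2 hR_nonneg] with ω hle hnn hRnn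
    exact (norm_inv_smul_urnComposition_le _ hnn hRnn (Nat.cast_nonneg n) n).trans hle
  · exact convergesAEAndL1_of_dominated
      (fun n => ((hNm n).const_smul ((n : ℝ)⁻¹)).aestronglyMeasurable) hone
      (fun _ => memLp_const 1)
      (fun n => Eventually.of_forall fun ω => norm_inv_smul_urnCount_le _ _ _ n)
      (hpath.mono fun ω hω => hω.2.2.2)
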